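/- Let $n\ge 2$, $s\in(0,1)$ and $0<\lambda\le\Lambda$. There is a constant $C=C(n,s,\lambda,\Lambda)$ with the following property. Let $K$ be a kernel in the class $\mathcal L_2(s,\lambda,\Lambda)$, that is, $K(z)=K(-z)$, and for all $z\in\mathbb R^n\setminus\{0\}$ and all unit vectors $e$, $$\frac{\lambda}{|z|^{n+s}}\le K(z)\le\frac{\Lambda}{|z|^{n+s}},\qquad \max\bigl\{|z|\,|\partial_eK(z)|,\ |z|^2\,|\partial_{ee}K(z)|\bigr\}\le\frac{\Lambda}{|z|^{n+s}},$$ where the derivatives $\partial_eK(z)$, $\partial_{ee}K(z)$ are assumed to exist. For measurable sets put $L_K(A,B)=\int_A\int_B K(x-\bar x)\,d\bar x\,dx$ and, with $\mathcal CE=\mathbb R^n\setminus E$, $$P_{K,\Omega}(E)=L_K(E\cap\Omega,\mathcal CE\cap\Omega)+L_K(E\cap\Omega,\mathcal CE\setminus\Omega)+L_K(E\setminus\Omega,\mathcal CE\cap\Omega).$$ Let $B_r$ be the open ball of radius $r$ centred at $0$, and let $E\subset\mathbb R^n$ be a measurable set that is stable for $P_{K,B_4}$, that is: $P_{K,B_4}(E)<\infty$,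 and for every vector field $X=X(x,t)\in C^2_c(B_4\times(-1,1);\mathbb R^n)$ and every $\varepsilon>0$ there is $t_0>0$ such that, denoting by $\Psi_t$ the integral flow of $X$ ($\Psi_0=\mathrm{id}$, $\partial_t\Psi_t(x)=X(\Psi_t(x),t)$) and $F_t=\Psi_t(E)$, $$0\le P_{K,B_4}(F_t\cup E)-P_{K,B_4}(E)+\varepsilon t^2\quad\text{and}\quad 0\le P_{K,B_4}(F_t\cap E)-P_{K,B_4}(E)+\varepsilon t^2\qquad\text{for all }t\in(-t_0,t_0).$$ Then $\chi_E\in BV(B_1)$ and $$\mathrm{Per}_{B_1}(E)=|\nabla\chi_E|(B_1)=\sup\Bigl\{\int_{B_1}\chi_E\,\mathrm{div}\,\phi\,dx\ :\ \phi\in C^1_c(B_1;\mathbb R^n),\ |\phi|\le1\Bigr\}\le C.$$ -/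

import Mathlib

open MeasureTheory Set
open scoped ENNReal NNReal

namespace NonlocalPerimeter

noncomputable section

/-- The Euclidean space `ℝⁿ`. -/
abbrev Rn (n : ℕ) : Type := EuclideanSpace ℝ (Fin n)

/-! ### Kernels and the nonlocal perimeter -/

/-- The class `𝓛₂(s, lam, Lam)` of even kernels on `ℝⁿ ∖ {0}` comparable to `|z|^{-(n+s)}`, which
have first and second derivatives `∂ₑK`, `∂ₑₑK` in every unit direction `e` at every `z ≠ 0`,
controlled by `Lam |z|^{-(n+s)-1}` and `Lam |z|^{-(n+s)-2}`. The value `K 0` plays no role. -/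
structure KernelClassL2 {n : ℕ} (s lam Lam : ℝ) (K : Rn n → ℝ) : Prop where
  even : ∀ z : Rn n, K (-z) = K z
  lower : ∀ z : Rn n, z ≠ 0 → lam / ‖z‖ ^ ((n : ℝ) + s) ≤ K z
  upper : ∀ z : Rn n, z ≠ 0 → K z ≤ Lam / ‖z‖ ^ ((n : ℝ) + s)
  lineDiff : ∀ z e : Rn n, z ≠ 0 → ‖e‖ = 1 → LineDifferentiableAt ℝ K z e
  lineDiff₂ : ∀ z e : Rn n, z ≠ 0 → ‖e‖ = 1 →
    LineDifferentiableAt ℝ (fun y => lineDeriv ℝ K y e) z e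
  deriv_bound : ∀ z e : Rn n, z ≠ 0 → ‖e‖ = 1 →
    max (‖z‖ * |lineDeriv ℝ K z e|)
      (‖z‖ ^ 2 * |lineDeriv ℝ (fun y => lineDeriv ℝ K y e) z e|) ≤ Lam / ‖z‖ ^ ((n : ℝ) + s)

/-- The interaction `L_K(A, B) = ∫_A ∫_B K(x - y) dy dx`, with values in `[0, ∞]`. -/
def interaction {n : ℕ} (K : Rn n → ℝ) (A B : Set (Rn n)) : ℝ≥0∞ :=
  ∫⁻ x in A, ∫⁻ y in B, ENNReal.ofReal (K (x - y))

/-- The `K`-perimeter `P_{K,Ω}(E)` of `E` inside `Ω`. -/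
def kPerimeter {n : ℕ} (K : Rn n → ℝ) (Ω E : Set (Rn n)) : ℝ≥0∞ :=
  interaction K (E ∩ Ω) (Eᶜ ∩ Ω) + interaction K (E ∩ Ω) (Eᶜ \ Ω)
    + interaction K (E \ Ω) (Eᶜ ∩ Ω)

/-! ### Stable sets -/

/-- `X ∈ C²_c(Ω × (-1,1); ℝⁿ)`: a time-dependent vector field of class `C²` with compact support
contained in `Ω × (-1,1)`. -/
structure IsAdmissibleField {n : ℕ} (Ω : Set (Rn n)) (X : Rn n × ℝ → Rn n) : Prop where
  contDiff : ContDiff ℝ 2 X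
  compactSupport : HasCompactSupport X
  tsupport_subset : tsupport X ⊆ Ω ×ˢ Ioo (-1 : ℝ) 1

/-- `Ψ` is the integral flow of the time-dependent field `X`, for times in `(-1,1)`:
`Ψ₀ = id` and `∂ₜ Ψₜ(x) = X(Ψₜ(x), t)`. -/
structure IsIntegralFlow {n : ℕ} (X : Rn n × ℝ → Rn n) (Ψ : ℝ → Rn n → Rn n) : Prop where
  zero : ∀ x, Ψ 0 x = x
  deriv : ∀ x, ∀ t ∈ Ioo (-1 : ℝ) 1, HasDerivAt (fun τ => Ψ τ x) (X (Ψ t x, t)) t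

/-- `E` is a stable set for `P_{K,Ω}`: its `K`-perimeter in `Ω` is finite, and for every admissible
field with flow `Ψ` and every `ε > 0` there is `t₀ > 0` such that for `|t| < t₀`, with
`Fₜ = Ψₜ(E)`, both `P(Fₜ ∪ E) - P(E) + ε t²` and `P(Fₜ ∩ E) - P(E) + ε t²` are nonnegative
(here `P(E) < ∞`, so `P(E)` may be moved to the other side). -/
def IsStableSet {n : ℕ} (K : Rn n → ℝ) (Ω E : Set (Rn n)) : Prop :=
  kPerimeter K Ω E < ∞ ∧
  ∀ X : Rn n × ℝ → Rn n, IsAdmissibleField Ω X →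
  ∀ Ψ : ℝ → Rn n → Rn n, IsIntegralFlow X Ψ →
  ∀ ε : ℝ, 0 < ε → ∃ t₀ : ℝ, 0 < t₀ ∧ ∀ t ∈ Ioo (-t₀) t₀,
    kPerimeter K Ω E ≤ kPerimeter K Ω (Ψ t '' E ∪ E) + ENNReal.ofReal (ε * t ^ 2) ∧
    kPerimeter K Ω E ≤ kPerimeter K Ω (Ψ t '' E ∩ E) + ENNReal.ofReal (ε * t ^ 2)

/-! ### Functions of bounded variation and the classical perimeter -/

/-- The divergence of a vector field on `ℝⁿ`. -/
def divergence {n : ℕ} (φ : Rn n → Rn n) (x : Rn n) : ℝ :=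
  ∑ i : Fin n, (fderiv ℝ φ x (EuclideanSpace.single i 1)) i

/-- The competitors in the total variation: `φ ∈ C¹_c(Ω; ℝⁿ)` with `|φ| ≤ 1`. -/
structure IsTestField {n : ℕ} (Ω : Set (Rn n)) (φ : Rn n → Rn n) : Prop where
  contDiff : ContDiff ℝ 1 φ
  compactSupport : HasCompactSupport φ
  tsupport_subset : tsupport φ ⊆ Ω
  norm_le_one : ∀ x, ‖φ x‖ ≤ 1

/-- The total variation `|∇u|(Ω) = sup ∫_Ω u div φ` in `[0, ∞]`, for `u ∈ L¹(Ω)`. Since `φ = 0` is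
a competitor, truncating the integrals at `0` does not change the supremum. -/
def totalVariation {n : ℕ} (u : Rn n → ℝ) (Ω : Set (Rn n)) : ℝ≥0∞ :=
  ⨆ (φ : Rn n → Rn n) (_ : IsTestField Ω φ),
    ENNReal.ofReal (∫ x in Ω, u x * divergence φ x)

/-- `u ∈ BV(Ω)`. -/
def MemBV {n : ℕ} (u : Rn n → ℝ) (Ω : Set (Rn n)) : Prop :=
  IntegrableOn u Ω ∧ totalVariation u Ω < ∞

/-- The characteristic function `χ_E`. -/
def charFun {n : ℕ} (E : Set (Rn n)) : Rn n → ℝ := E.indicator fun _ => 1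

/-- The classical perimeter `Per_Ω(E) = |∇χ_E|(Ω)`. -/
def perimeter {n : ℕ} (Ω E : Set (Rn n)) : ℝ≥0∞ := totalVariation (charFun E) Ω

end

end NonlocalPerimeter

/-!
Deform `E` by the shear `F = {x + t η(x) e : x ∈ E}`, where `η = 1` on `B_r`. The union and the
intersection of `F` and `E` save the interaction of `F \ E` with `E \ F` over `P(F) + P(E)`, and the
symmetric second difference `P(F_t) + P(F_{-t}) - 2 P(E)` is at most `C t² P(E)`, so stability
bounds this interaction by `C t² P(E)`. On a bounded region the kernel is bounded below, hence
`|F \ E| |E \ F| ≤ C t² P(E)` inside `B_r`, where `F` is the translate `E + t e`. There the two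
factors differ by at most `C t`, as translating a ball shows, so both are at most `C t √(1 + P(E))`,
which is a `BV` estimate in `B_r`.

Conversely, as `s < 1`, a `BV` estimate with constant `w` on a larger ball bounds the `K`-perimeter
by `C (1 + w)`. Combining both, the constant on `B_r` is at most `√(C (1 + w) / (R - r)^m)` where
`w` is the constant on `B_R`, and iterating over shrinking shells absorbs `w`.
-/

namespace NonlocalPerimeter

open Filter Topology

/-! ### Kernels along lines -/

section LineDifferentiation

variable {V : Type*} [NormedAddCommGroup V] [NormedSpace ℝ V]

theorem hasDerivAt_comp_add_smul {F : Type*} [NormedAddCommGroup F] [NormedSpace ℝ F]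
    {f : V → F} {z e : V} {τ : ℝ} (h : LineDifferentiableAt ℝ f (z + τ • e) e) :
    HasDerivAt (fun σ : ℝ => f (z + σ • e)) (lineDeriv ℝ f (z + τ • e) e) τ := by
  have hline : HasDerivAt (fun σ : ℝ => f (z + τ • e + σ • e))
      (lineDeriv ℝ f (z + τ • e) e) (τ - τ) := by
    rw [sub_self]; exact h.hasLineDerivAt
  refine (hline.comp_sub_const τ τ).congr_of_eventuallyEq (Eventually.of_forall fun σ => ?_)
  simp only [add_assoc, ← add_smul, add_sub_cancel]

theorem half_norm_le_norm_add_smul {z e : V} (he : ‖e‖ = 1) {σ : ℝ} (hσ : |σ| ≤ ‖z‖ / 2) :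
    ‖z‖ / 2 ≤ ‖z + σ • e‖ := by
  have hz : ‖z‖ ≤ ‖z + σ • e‖ + ‖σ • e‖ := norm_le_add_norm_add z (σ • e)
  rw [norm_smul, he, mul_one, Real.norm_eq_abs] at hz
  linarith

theorem add_smul_ne_zero {z e : V} (hz : z ≠ 0) (he : ‖e‖ = 1) {σ : ℝ} (hσ : |σ| ≤ ‖z‖ / 2) :
    z + σ • e ≠ 0 :=
  norm_pos_iff.1 ((half_pos (norm_pos_iff.2 hz)).trans_le (half_norm_le_norm_add_smul he hσ))

theorem abs_sub_zero_le_of_hasDerivAt {f f' : ℝ → ℝ} {ρ D : ℝ}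
    (hf : ∀ σ, |σ| ≤ ρ → HasDerivAt f (f' σ) σ) (hD : ∀ σ, |σ| ≤ ρ → |f' σ| ≤ D)
    {τ : ℝ} (hτ : |τ| ≤ ρ) : |f τ - f 0| ≤ D * |τ| := by
  simpa using (convex_Icc (-ρ) ρ).norm_image_sub_le_of_norm_hasDerivWithin_le (C := D)
    (fun σ hσ => (hf σ (abs_le.2 hσ)).hasDerivWithinAt) (fun σ hσ => hD σ (abs_le.2 hσ))
    (abs_le.1 (abs_zero.trans_le ((abs_nonneg τ).trans hτ))) (abs_le.1 hτ)

theorem abs_add_neg_sub_two_mul_le_of_hasDerivAt {f f' f'' : ℝ → ℝ} {ρ D : ℝ}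
    (hf : ∀ σ, |σ| ≤ ρ → HasDerivAt f (f' σ) σ) (hf' : ∀ σ, |σ| ≤ ρ → HasDerivAt f' (f'' σ) σ)
    (hD : ∀ σ, |σ| ≤ ρ → |f'' σ| ≤ D) {τ : ℝ} (hτ : |τ| ≤ ρ) :
    |f τ + f (-τ) - 2 * f 0| ≤ 2 * D * τ ^ 2 := by
  have hD0 : 0 ≤ D := (abs_nonneg _).trans (hD τ hτ)
  have hneg : ∀ σ, |σ| ≤ |τ| → |-σ| ≤ ρ := fun σ hσ => by rw [abs_neg]; exact hσ.trans hτ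
  have hderiv : ∀ σ, |σ| ≤ |τ| → HasDerivAt (fun σ => f σ + f (-σ)) (f' σ - f' (-σ)) σ := by
    intro σ hσ
    have hrefl : HasDerivAt (f ∘ Neg.neg) (-f' (-σ)) σ := by
      simpa using (hf (-σ) (hneg σ hσ)).scomp σ (hasDerivAt_neg σ)
    exact sub_eq_add_neg (f' σ) _ ▸ (hf σ (hσ.trans hτ)).fun_add hrefl
  have hbound : ∀ σ, |σ| ≤ |τ| → |f' σ - f' (-σ)| ≤ 2 * D * |τ| := by
    intro σ hσ
    have hplus := abs_sub_zero_le_of_hasDerivAt hf' hD (hσ.trans hτ)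
    have hminus := abs_sub_zero_le_of_hasDerivAt hf' hD (hneg σ hσ)
    rw [abs_neg] at hminus
    calc |f' σ - f' (-σ)| ≤ |f' σ - f' 0| + |f' 0 - f' (-σ)| := abs_sub_le ..
      _ ≤ D * |σ| + D * |σ| := by rw [abs_sub_comm (f' 0)]; gcongr
      _ ≤ 2 * D * |τ| := by rw [two_mul, add_mul]; gcongr
  have h := abs_sub_zero_le_of_hasDerivAt hderiv hbound le_rfl
  rwa [neg_zero, ← two_mul, mul_assoc, abs_mul_abs_self, ← sq] at h

end LineDifferentiation

/-- The constant `A` of the Harnack type bound `Lam / (‖z‖ / 2) ^ (n + s) ≤ A * K z` for kernels of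
the class `𝓛₂(s, lam, Lam)`. -/
noncomputable def harnackConst (n : ℕ) (s lam Lam : ℝ) : ℝ :=
  2 ^ ((n : ℝ) + s) * (Lam / lam)

namespace KernelClassL2

variable {n : ℕ} {s lam Lam : ℝ} {K : Rn n → ℝ} {z : Rn n}

theorem lam_le (hK : KernelClassL2 s lam Lam K) (hz : z ≠ 0) : lam ≤ Lam :=
  (div_le_div_iff_of_pos_right (Real.rpow_pos_of_pos (norm_pos_iff.2 hz) _)).1
    ((hK.lower z hz).trans (hK.upper z hz))

theorem pos (hK : KernelClassL2 s lam Lam K) (hlam : 0 < lam) (hz : z ≠ 0) : 0 < K z :=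
  (div_pos hlam (Real.rpow_pos_of_pos (norm_pos_iff.2 hz) _)).trans_le (hK.lower z hz)

theorem one_le_harnackConst (hK : KernelClassL2 s lam Lam K) (hs : 0 < s) (hlam : 0 < lam)
    (hz : z ≠ 0) : 1 ≤ harnackConst n s lam Lam :=
  one_le_mul_of_one_le_of_one_le (Real.one_le_rpow one_le_two (by positivity))
    ((one_le_div hlam).2 (hK.lam_le hz))

theorem div_half_norm_rpow_le (hK : KernelClassL2 s lam Lam K) (hlam : 0 < lam) (hz : z ≠ 0) :
    Lam / (‖z‖ / 2) ^ ((n : ℝ) + s) ≤ harnackConst n s lam Lam * K z := by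
  have hLam : 0 < Lam := hlam.trans_le (hK.lam_le hz)
  have : 0 < ‖z‖ ^ ((n : ℝ) + s) := Real.rpow_pos_of_pos (norm_pos_iff.2 hz) _
  calc Lam / (‖z‖ / 2) ^ ((n : ℝ) + s)
      = harnackConst n s lam Lam * (lam / ‖z‖ ^ ((n : ℝ) + s)) := by
        rw [Real.div_rpow (norm_nonneg z) zero_le_two, harnackConst]
        field_simp
    _ ≤ harnackConst n s lam Lam * K z :=
        mul_le_mul_of_nonneg_left (hK.lower z hz) (by unfold harnackConst; positivity)

theorem max_lineDeriv_le (hK : KernelClassL2 s lam Lam K) (hs : 0 < s) (hlam : 0 < lam)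
    (hz : z ≠ 0) {w e : Rn n} (he : ‖e‖ = 1) (hw : ‖z‖ / 2 ≤ ‖w‖) :
    max (‖w‖ * |lineDeriv ℝ K w e|)
      (‖w‖ ^ 2 * |lineDeriv ℝ (fun y => lineDeriv ℝ K y e) w e|) ≤
        harnackConst n s lam Lam * K z := by
  have hr : 0 < ‖z‖ / 2 := half_pos (norm_pos_iff.2 hz)
  have hLam : 0 < Lam := hlam.trans_le (hK.lam_le hz)
  calc _ ≤ Lam / ‖w‖ ^ ((n : ℝ) + s) := hK.deriv_bound w e (norm_pos_iff.1 (hr.trans_le hw)) he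
    _ ≤ Lam / (‖z‖ / 2) ^ ((n : ℝ) + s) := by gcongr
    _ ≤ harnackConst n s lam Lam * K z := hK.div_half_norm_rpow_le hlam hz

theorem abs_lineDeriv_le (hK : KernelClassL2 s lam Lam K) (hs : 0 < s) (hlam : 0 < lam)
    (hz : z ≠ 0) {w e : Rn n} (he : ‖e‖ = 1) (hw : ‖z‖ / 2 ≤ ‖w‖) :
    |lineDeriv ℝ K w e| ≤ harnackConst n s lam Lam * K z / (‖z‖ / 2) := by
  rw [le_div_iff₀' (half_pos (norm_pos_iff.2 hz))]
  exact (mul_le_mul_of_nonneg_right hw (abs_nonneg _)).trans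
    ((le_max_left ..).trans (hK.max_lineDeriv_le hs hlam hz he hw))

theorem abs_lineDeriv_lineDeriv_le (hK : KernelClassL2 s lam Lam K) (hs : 0 < s) (hlam : 0 < lam)
    (hz : z ≠ 0) {w e : Rn n} (he : ‖e‖ = 1) (hw : ‖z‖ / 2 ≤ ‖w‖) :
    |lineDeriv ℝ (fun y => lineDeriv ℝ K y e) w e| ≤
      harnackConst n s lam Lam * K z / (‖z‖ / 2) ^ 2 := by
  rw [le_div_iff₀' (pow_pos (half_pos (norm_pos_iff.2 hz)) 2)]
  exact (mul_le_mul_of_nonneg_right (by gcongr) (abs_nonneg _)).trans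
    ((le_max_right ..).trans (hK.max_lineDeriv_le hs hlam hz he hw))

theorem abs_sub_le (hK : KernelClassL2 s lam Lam K) (hs : 0 < s) (hlam : 0 < lam)
    (hz : z ≠ 0) {e : Rn n} (he : ‖e‖ = 1) {τ : ℝ} (hτ : |τ| ≤ ‖z‖ / 2) :
    |K (z + τ • e) - K z| ≤ harnackConst n s lam Lam * K z / (‖z‖ / 2) * |τ| := by
  simpa using abs_sub_zero_le_of_hasDerivAt (f := fun σ => K (z + σ • e))
    (fun σ hσ => hasDerivAt_comp_add_smul (hK.lineDiff _ e (add_smul_ne_zero hz he hσ) he))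
    (fun σ hσ => hK.abs_lineDeriv_le hs hlam hz he (half_norm_le_norm_add_smul he hσ)) hτ

theorem abs_add_sub_two_mul_le (hK : KernelClassL2 s lam Lam K) (hs : 0 < s) (hlam : 0 < lam)
    (hz : z ≠ 0) {e : Rn n} (he : ‖e‖ = 1) {τ : ℝ} (hτ : |τ| ≤ ‖z‖ / 2) :
    |K (z + τ • e) + K (z - τ • e) - 2 * K z| ≤
      2 * (harnackConst n s lam Lam * K z / (‖z‖ / 2) ^ 2) * τ ^ 2 := by
  simpa [sub_eq_add_neg] using abs_add_neg_sub_two_mul_le_of_hasDerivAt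
    (f := fun σ => K (z + σ • e))
    (fun σ hσ => hasDerivAt_comp_add_smul (hK.lineDiff _ e (add_smul_ne_zero hz he hσ) he))
    (fun σ hσ => hasDerivAt_comp_add_smul (f := fun y => lineDeriv ℝ K y e)
      (hK.lineDiff₂ _ e (add_smul_ne_zero hz he hσ) he))
    (fun σ hσ => hK.abs_lineDeriv_lineDeriv_le hs hlam hz he (half_norm_le_norm_add_smul he hσ)) hτ

theorem continuousAt (hK : KernelClassL2 s lam Lam K) (hs : 0 < s) (hlam : 0 < lam)
    (hz : z ≠ 0) : ContinuousAt K z := by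
  refine continuousAt_of_locally_lipschitz (half_pos (norm_pos_iff.2 hz))
    (harnackConst n s lam Lam * K z / (‖z‖ / 2)) fun w hw => ?_
  rcases eq_or_ne w z with rfl | hwz
  · simp
  have hd : ‖w - z‖ ≠ 0 := norm_ne_zero_iff.2 (sub_ne_zero.2 hwz)
  rw [dist_eq_norm] at hw
  have h := hK.abs_sub_le hs hlam hz (e := ‖w - z‖⁻¹ • (w - z)) (τ := ‖w - z‖)
    (by rw [norm_smul, norm_inv, norm_norm, inv_mul_cancel₀ hd]) (by rw [abs_norm]; exact hw.le)
  rwa [smul_inv_smul₀ hd, add_sub_cancel, abs_norm, ← Real.dist_eq, ← dist_eq_norm] at h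

theorem measurable (hK : KernelClassL2 s lam Lam K) (hs : 0 < s) (hlam : 0 < lam) :
    Measurable K :=
  measurable_of_continuousOn_compl_singleton 0
    (continuousOn_of_forall_continuousAt fun _ hz => hK.continuousAt hs hlam hz)

end KernelClassL2

theorem mul_add_mul_le_of_symmetric_differences {k kp km α β m A : ℝ} (hm : m ≤ 1 / 2)
    (hα : |α| ≤ m) (hβ : |β| ≤ m) (hk : 0 ≤ k) (hA : 1 ≤ A)
    (h₁ : |kp - km| ≤ 4 * A * k * m) (h₂ : |kp + km - 2 * k| ≤ 8 * A * k * m ^ 2) :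
    kp * ((1 + α) * (1 + β)) + km * ((1 - α) * (1 - β)) ≤ (2 + 32 * A * m ^ 2) * k := by
  have hm0 : 0 ≤ m := (abs_nonneg α).trans hα
  have hαβ : |α * β| ≤ m ^ 2 := by rw [abs_mul, sq]; gcongr
  have hm1 : m ^ 2 ≤ 1 := by nlinarith
  have hSum : |α + β| ≤ 2 * m := (abs_add_le _ _).trans (by linarith)
  have hOne : |1 + α * β| ≤ 2 := (abs_add_le _ _).trans (by rw [abs_one]; linarith)
  have hEven : (kp + km - 2 * k) * (1 + α * β) ≤ 8 * A * k * m ^ 2 * 2 :=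
    (le_abs_self _).trans (by rw [abs_mul]; gcongr)
  have hOdd : (kp - km) * (α + β) ≤ 4 * A * k * m * (2 * m) :=
    (le_abs_self _).trans (by rw [abs_mul]; gcongr)
  have hProd : 2 * k * (α * β) ≤ 2 * k * (A * m ^ 2) :=
    mul_le_mul_of_nonneg_left (((le_abs_self _).trans hαβ).trans
      (le_mul_of_one_le_left (sq_nonneg m) hA)) (by positivity)
  have hAm : 0 ≤ A * m ^ 2 * k := by positivity
  calc kp * ((1 + α) * (1 + β)) + km * ((1 - α) * (1 - β))
      = 2 * k + ((kp + km - 2 * k) * (1 + α * β) + (kp - km) * (α + β) + 2 * k * (α * β)) := by ring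
    _ ≤ 2 * k + (8 * A * k * m ^ 2 * 2 + 4 * A * k * m * (2 * m) + 2 * k * (A * m ^ 2)) := by gcongr
    _ ≤ (2 + 32 * A * m ^ 2) * k := by linarith

theorem KernelClassL2.symmetric_deformation_le {n : ℕ} {s lam Lam : ℝ} {K : Rn n → ℝ}
    (hK : KernelClassL2 s lam Lam K) (hs : 0 < s) (hlam : 0 < lam) {z e : Rn n} (hz : z ≠ 0)
    (he : ‖e‖ = 1) {m τ α β : ℝ} (hm : m ≤ 1 / 2) (hτ : |τ| ≤ m * ‖z‖) (hα : |α| ≤ m)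
    (hβ : |β| ≤ m) :
    K (z + τ • e) * ((1 + α) * (1 + β)) + K (z - τ • e) * ((1 - α) * (1 - β)) ≤
      (2 + 32 * harnackConst n s lam Lam * m ^ 2) * K z := by
  set A := harnackConst n s lam Lam
  have hA : 1 ≤ A := hK.one_le_harnackConst hs hlam hz
  have hr : 0 < ‖z‖ := norm_pos_iff.2 hz
  have hk : 0 < K z := hK.pos hlam hz
  have : 0 ≤ m := (abs_nonneg α).trans hα
  have hτz : |τ| ≤ ‖z‖ / 2 := hτ.trans (by nlinarith)
  refine mul_add_mul_le_of_symmetric_differences hm hα hβ hk.le hA ?_ ?_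
  · have hplus := hK.abs_sub_le hs hlam hz he hτz
    have hminus := hK.abs_sub_le hs hlam hz he (τ := -τ) (by rwa [abs_neg])
    rw [neg_smul, ← sub_eq_add_neg, abs_neg, abs_sub_comm] at hminus
    calc |K (z + τ • e) - K (z - τ • e)|
        ≤ |K (z + τ • e) - K z| + |K z - K (z - τ • e)| := _root_.abs_sub_le ..
      _ ≤ 2 * (A * K z / (‖z‖ / 2) * (m * ‖z‖)) := by
          rw [two_mul]
          gcongr
          · exact hplus.trans (by gcongr)
          · exact hminus.trans (by gcongr)
      _ = 4 * A * K z * m := by field_simp; ring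
  · have hsq : τ ^ 2 ≤ (m * ‖z‖) ^ 2 := by rw [← sq_abs τ]; gcongr
    calc |K (z + τ • e) + K (z - τ • e) - 2 * K z|
        ≤ 2 * (A * K z / (‖z‖ / 2) ^ 2) * τ ^ 2 := hK.abs_add_sub_two_mul_le hs hlam hz he hτz
      _ ≤ 2 * (A * K z / (‖z‖ / 2) ^ 2) * (m * ‖z‖) ^ 2 := by gcongr
      _ = 8 * A * K z * m ^ 2 := by field_simp; ring

/-! ### Deformations as integral flows -/

section Perturbation

variable {V : Type*} [NormedAddCommGroup V] [NormedSpace ℝ V] [CompleteSpace V]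

theorem exists_homeomorph_id_add {w : V → V} (hw : LipschitzWith (1 / 2) w) :
    ∃ G : V ≃ₜ V, ∀ x, G x = x + w x := by
  have happrox : ApproximatesLinearOn (fun x => x + w x)
      (ContinuousLinearEquiv.refl ℝ V : V →L[ℝ] V) univ (1 / 2) := by
    intro x _ y _
    simpa [add_sub_add_comm] using hw.norm_sub_le x y
  have hinv : Subsingleton V ∨
      (1 / 2 : ℝ≥0) < ‖((ContinuousLinearEquiv.refl ℝ V).symm : V →L[ℝ] V)‖₊⁻¹ := by
    rcases subsingleton_or_nontrivial V with hV | hV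
    · exact Or.inl hV
    right
    have hid : ‖ContinuousLinearMap.id ℝ V‖₊ = 1 := nnnorm_one (G := V →L[ℝ] V)
    simpa [hid] using NNReal.half_lt_self one_ne_zero
  exact ⟨happrox.toHomeomorph _ hinv, fun _ => rfl⟩

theorem contDiff_symm_of_eq_id_add {k : WithTop ℕ∞} (hk : k ≠ 0) {w : V → V} (hw : ContDiff ℝ k w)
    (hL : LipschitzWith (1 / 2) w) {G : V ≃ₜ V} (hG : ∀ x, G x = x + w x) :
    ContDiff ℝ k G.symm := by
  have hG' : ⇑G = fun x => x + w x := funext hG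
  have hnorm : ∀ a, ‖-fderiv ℝ w a‖ < 1 := fun a => by
    rw [norm_neg]
    exact (norm_fderiv_le_of_lipschitz ℝ hL).trans_lt (by norm_num)
  refine G.contDiff_symm (f₀' := fun a => ContinuousLinearEquiv.ofUnit
    (Units.oneSub (-fderiv ℝ w a) (hnorm a))) (fun a => ?_) (hG' ▸ contDiff_id.add hw)
  rw [hG']
  refine ((hasFDerivAt_id a).add (hw.differentiable hk a).hasFDerivAt).congr_fderiv ?_
  exact (sub_neg_eq_add 1 (fderiv ℝ w a)).symm

theorem exists_homeomorph_fst_add {g : V × ℝ → V} (hg : ContDiff ℝ 2 g)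
    (hL : LipschitzWith (1 / 2) g) :
    ∃ G : V × ℝ ≃ₜ V × ℝ, (∀ p, G p = (p.1 + g p, p.2)) ∧ ContDiff ℝ 2 G.symm := by
  have hw : LipschitzWith (1 / 2) fun p => (g p, (0 : ℝ)) := by
    simpa using hL.prodMk (LipschitzWith.const (0 : ℝ))
  obtain ⟨G, hG⟩ := exists_homeomorph_id_add hw
  exact ⟨G, fun p => by simp [hG, Prod.ext_iff], contDiff_symm_of_eq_id_add two_ne_zero
    (hg.prodMk contDiff_const) hw hG⟩

end Perturbation

theorem exists_pos_lipschitzWith_const_smul {V W : Type*} [NormedAddCommGroup V] [NormedSpace ℝ V]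
    [NormedAddCommGroup W] [NormedSpace ℝ W] {g : V → W} (hg : ContDiff ℝ 1 g)
    (hgc : HasCompactSupport g) :
    ∃ c : ℝ, 0 < c ∧ LipschitzWith (1 / 2) fun x => c • g x := by
  obtain ⟨L, hL⟩ := hg.lipschitzWith_of_hasCompactSupport hgc one_ne_zero
  let c : ℝ≥0 := (2 * (L + 1))⁻¹
  have hcL : c * L ≤ 1 / 2 := by
    calc c * L = 2⁻¹ * ((L + 1)⁻¹ * L) := by rw [← mul_assoc, ← mul_inv]
      _ ≤ 2⁻¹ * 1 := by gcongr; exact inv_mul_le_one_of_le₀ le_self_add zero_le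
      _ = 1 / 2 := by rw [mul_one, one_div]
  refine ⟨c, by positivity, ((lipschitzWith_smul (c : ℝ)).comp hL).weaken ?_⟩
  simpa using hcL

theorem exists_contDiff_eq_self_near_zero :
    ∃ θ : ℝ → ℝ, ContDiff ℝ 3 θ ∧ tsupport θ ⊆ Icc (-(1 / 2)) (1 / 2) ∧
      ∀ t, |t| ≤ 1 / 4 → θ t = t := by
  let b : ContDiffBump (0 : ℝ) := ⟨1 / 4, 1 / 2, by norm_num, by norm_num⟩
  refine ⟨fun t => t * b t, contDiff_id.mul b.contDiff, ?_, fun t ht => ?_⟩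
  · calc tsupport (fun t => t * b t) ⊆ tsupport b := tsupport_mul_subset_right
      _ = Icc (-(1 / 2)) (1 / 2) := by rw [b.tsupport_eq, Real.closedBall_eq_Icc]; simp [b]
  · simp [b.one_of_mem_closedBall (mem_closedBall_zero_iff.2 ht)]

theorem exists_admissible_flow {n : ℕ} {Ω : Set (Rn n)} {ξ : Rn n → Rn n} (hξ : ContDiff ℝ 2 ξ)
    (hξc : HasCompactSupport ξ) (hξΩ : tsupport ξ ⊆ Ω) :
    ∃ c : ℝ, 0 < c ∧ ∃ X Ψ, IsAdmissibleField Ω X ∧ IsIntegralFlow X Ψ ∧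
      ∀ t, |t| ≤ 1 / 4 → ∀ x, Ψ t x = x + (c * t) • ξ x := by
  obtain ⟨θ, hθ, hθsupp, hθ_eq⟩ := exists_contDiff_eq_self_near_zero
  have hθ' : ContDiff ℝ 2 (deriv θ) := (contDiff_succ_iff_deriv (n := 2).1 hθ).2.2
  let B : Set (Rn n × ℝ) := tsupport ξ ×ˢ Icc (-(1 / 2)) (1 / 2)
  have hB : IsCompact B := hξc.isCompact.prod isCompact_Icc
  let g : Rn n × ℝ → Rn n := fun p => θ p.2 • ξ p.1
  have hg : ContDiff ℝ 2 g :=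
    ((hθ.of_le (by norm_num)).comp contDiff_snd).smul (hξ.comp contDiff_fst)
  have hgc : HasCompactSupport g := HasCompactSupport.intro hB fun p hp => by
    rcases not_and_or.1 hp with hp | hp
    · exact smul_eq_zero_of_right _ (image_eq_zero_of_notMem_tsupport hp)
    · exact smul_eq_zero_of_left (image_eq_zero_of_notMem_tsupport fun h => hp (hθsupp h)) _
  obtain ⟨c, hc, hL⟩ := exists_pos_lipschitzWith_const_smul (hg.of_le one_le_two) hgc
  obtain ⟨G, hG, hGsymm⟩ := exists_homeomorph_fst_add (hg.const_smul c) hL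
  -- `G` is the space-time graph of the deformation, so the generating field is `∂ₜG ∘ G⁻¹`.
  let X : Rn n × ℝ → Rn n := fun q => c • deriv θ q.2 • ξ (G.symm q).1
  let Ψ : ℝ → Rn n → Rn n := fun t x => x + c • θ t • ξ x
  have hΨ : ∀ t x, (Ψ t x, t) = G (x, t) := fun t x => (hG (x, t)).symm
  have hXsupp : Function.support X ⊆ B := fun q hq => by
    have hne := smul_ne_zero_iff.1 (smul_ne_zero_iff.1 hq).2
    refine ⟨by_contra fun hq1 => hne.2 ?_, hθsupp (support_deriv_subset hne.1)⟩
    have hfix : G q = q := by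
      simp [hG, g, image_eq_zero_of_notMem_tsupport hq1]
    rw [G.symm_apply_eq.2 hfix.symm]
    exact image_eq_zero_of_notMem_tsupport hq1
  have hXB : tsupport X ⊆ B := closure_minimal hXsupp hB.isClosed
  refine ⟨c, hc, X, Ψ, ⟨?_, hB.of_isClosed_subset (isClosed_tsupport _) hXB, hXB.trans ?_⟩,
    ⟨fun x => ?_, fun x t _ => ?_⟩, fun t ht x => ?_⟩
  · have hX : ContDiff ℝ 2 fun q => deriv θ q.2 • ξ (G.symm q).1 :=
      (hθ'.comp contDiff_snd).smul (hξ.comp (contDiff_fst.comp hGsymm))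
    exact hX.const_smul c
  · exact prod_mono hξΩ (Icc_subset_Ioo (by norm_num) (by norm_num))
  · simp [Ψ, hθ_eq 0 (by norm_num)]
  · have hX : X (Ψ t x, t) = c • deriv θ t • ξ x := by
      simp only [X]
      rw [hΨ, G.symm_apply_apply]
    rw [hX]
    exact (((hθ.differentiable (by norm_num) t).hasDerivAt.smul_const _).const_smul c).const_add x
  · simp [Ψ, hθ_eq t ht, smul_smul]

/-! ### The nonlocal perimeter as an integral over pairs -/

section Crossing

variable {α : Type*}

/-- Pairs separated by `E` with at least one member in `Ω`: the nonlocal perimeter is the integral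
of the kernel over this set. -/
def crossing (Ω E : Set α) : Set (α × α) := E ×ˢ Eᶜ \ Ωᶜ ×ˢ Ωᶜ

variable [MeasurableSpace α] {Ω E : Set α}

theorem measurableSet_crossing (hΩ : MeasurableSet Ω) (hE : MeasurableSet E) :
    MeasurableSet (crossing Ω E) :=
  (hE.prod hE.compl).diff (hΩ.compl.prod hΩ.compl)

theorem setLIntegral_crossing {μ : Measure α} [SFinite μ] (hΩ : MeasurableSet Ω)
    (hE : MeasurableSet E) {f : α × α → ℝ≥0∞} (hf : Measurable f) :
    ∫⁻ p in crossing Ω E, f p ∂μ.prod μ =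
      (∫⁻ x in E ∩ Ω, ∫⁻ y in Eᶜ ∩ Ω, f (x, y) ∂μ ∂μ)
      + (∫⁻ x in E ∩ Ω, ∫⁻ y in Eᶜ \ Ω, f (x, y) ∂μ ∂μ)
      + ∫⁻ x in E \ Ω, ∫⁻ y in Eᶜ ∩ Ω, f (x, y) ∂μ ∂μ := by
  have hsplit : crossing Ω E =
      (E ∩ Ω) ×ˢ (Eᶜ ∩ Ω) ∪ (E ∩ Ω) ×ˢ (Eᶜ \ Ω) ∪ (E \ Ω) ×ˢ (Eᶜ ∩ Ω) := by
    ext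
    simp only [crossing, mem_union, mem_prod, mem_inter_iff, Set.mem_sdiff, mem_compl_iff]
    tauto
  have hm₂ : MeasurableSet ((E ∩ Ω) ×ˢ (Eᶜ \ Ω)) := (hE.inter hΩ).prod (hE.compl.diff hΩ)
  have hm₃ : MeasurableSet ((E \ Ω) ×ˢ (Eᶜ ∩ Ω)) := (hE.diff hΩ).prod (hE.compl.inter hΩ)
  rw [hsplit, lintegral_union hm₃, lintegral_union hm₂]
  · simp only [setLIntegral_prod f hf.aemeasurable.restrict]
  · exact disjoint_sdiff_inter.symm.set_prod_right _ _
  · exact (disjoint_sdiff_inter.symm.set_prod_left _ _).union_left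
      (disjoint_sdiff_inter.symm.set_prod_left _ _)

end Crossing

section Kernel

variable {n : ℕ} {K : Rn n → ℝ}

theorem measurable_kernel_sub (hK : Measurable K) :
    Measurable fun p : Rn n × Rn n => ENNReal.ofReal (K (p.1 - p.2)) :=
  (hK.comp (measurable_fst.sub measurable_snd)).ennreal_ofReal

theorem kPerimeter_eq_setLIntegral (hK : Measurable K) {Ω E : Set (Rn n)}
    (hΩ : MeasurableSet Ω) (hE : MeasurableSet E) :
    kPerimeter K Ω E = ∫⁻ p in crossing Ω E, ENNReal.ofReal (K (p.1 - p.2)) :=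
  (setLIntegral_crossing hΩ hE (measurable_kernel_sub hK)).symm

end Kernel

/-! ### Shears -/

/-- The deformation `x ↦ x + t η(x) e` in the direction `e` with profile `η`. -/
def shear {V : Type*} [AddCommGroup V] [Module ℝ V] (η : V → ℝ) (e : V) (t : ℝ) (x : V) : V :=
  x + (t * η x) • e

theorem abs_mul_sub_le_of_lipschitzWith {V : Type*} [SeminormedAddCommGroup V] {η : V → ℝ}
    {M : ℝ≥0} (hM : LipschitzWith M η) (t : ℝ) (x y : V) :
    |t * (η x - η y)| ≤ |t| * M * ‖x - y‖ := by
  rw [abs_mul, mul_assoc]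
  gcongr
  exact hM.norm_sub_le x y

section Shear

variable {V : Type*} [NormedAddCommGroup V] [NormedSpace ℝ V] {η : V → ℝ} {e : V} {t : ℝ}

/-- The Jacobian determinant of `shear η e t`. -/
noncomputable def shearJacobian (η : V → ℝ) (e : V) (t : ℝ) (x : V) : ℝ :=
  1 + t * fderiv ℝ η x e

theorem shear_of_eq_zero {x : V} (h : η x = 0) : shear η e t x = x := by
  simp [shear, h]

theorem shear_sub_shear (x y : V) :
    shear η e t x - shear η e t y = (x - y) + (t * (η x - η y)) • e := by
  simp only [shear]; module

theorem hasFDerivAt_shear {x : V} (hη : DifferentiableAt ℝ η x) :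
    HasFDerivAt (shear η e t) (ContinuousLinearMap.id ℝ V + (t • fderiv ℝ η x).smulRight e) x :=
  (hasFDerivAt_id x).add ((hη.hasFDerivAt.const_mul t).smul_const e)

theorem det_id_add_smulRight_fderiv [FiniteDimensional ℝ V] (x : V) :
    (ContinuousLinearMap.id ℝ V + (t • fderiv ℝ η x).smulRight e).det = shearJacobian η e t x :=
  LinearMap.transvection.det _ _

theorem continuous_shear (hη : Continuous η) : Continuous (shear η e t) :=
  continuous_id.add ((continuous_const.mul hη).smul continuous_const)

theorem continuous_shearJacobian (hη : ContDiff ℝ 1 η) : Continuous (shearJacobian η e t) :=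
  continuous_const.add
    (continuous_const.mul ((hη.continuous_fderiv one_ne_zero).clm_apply continuous_const))

section Lipschitz

variable {M : ℝ≥0} (hM : LipschitzWith M η) (he : ‖e‖ = 1) (ht : |t| * M ≤ 1 / 2)
include hM he

theorem abs_mul_fderiv_apply_le (x : V) : |t * fderiv ℝ η x e| ≤ |t| * M := by
  rw [abs_mul]
  gcongr
  exact ((fderiv ℝ η x).unit_le_opNorm e he.le).trans (norm_fderiv_le_of_lipschitz ℝ hM)

include ht

theorem shearJacobian_nonneg (x : V) : 0 ≤ shearJacobian η e t x := by
  have h := (abs_le.1 ((abs_mul_fderiv_apply_le hM he x).trans ht)).1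
  unfold shearJacobian
  linarith

theorem lipschitzWith_smul_const : LipschitzWith (1 / 2) fun x => (t * η x) • e := by
  refine LipschitzWith.of_dist_le_mul fun x y => ?_
  rw [dist_eq_norm, dist_eq_norm, ← sub_smul, norm_smul, he, mul_one, ← mul_sub]
  exact (abs_mul_sub_le_of_lipschitzWith hM t x y).trans (by push_cast; gcongr)

theorem shear_bijective [CompleteSpace V] : Function.Bijective (shear η e t) := by
  obtain ⟨G, hG⟩ := exists_homeomorph_id_add (lipschitzWith_smul_const hM he ht)
  have hG' : ⇑G = shear η e t := funext hG
  exact hG' ▸ G.bijective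

theorem shear_image_eq_self [CompleteSpace V] {Ω : Set V} (hΩ : ∀ x ∉ Ω, η x = 0) :
    shear η e t '' Ω = Ω := by
  have hbij := shear_bijective hM he ht
  have hcompl : shear η e t '' Ωᶜ = Ωᶜ := by
    have h : EqOn (shear η e t) id Ωᶜ := fun x hx => shear_of_eq_zero (hΩ x hx)
    rw [h.image_eq, image_id]
  exact compl_injective (by rw [← image_compl_eq hbij, hcompl])

theorem setLIntegral_shear_image [FiniteDimensional ℝ V] [MeasurableSpace V] [BorelSpace V]
    (μ : Measure V) [μ.IsAddHaarMeasure] (hη : ContDiff ℝ 1 η) {A : Set V} (hA : MeasurableSet A)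
    (f : V → ℝ≥0∞) :
    ∫⁻ x in shear η e t '' A, f x ∂μ =
      ∫⁻ x in A, ENNReal.ofReal (shearJacobian η e t x) * f (shear η e t x) ∂μ := by
  have := FiniteDimensional.complete ℝ V
  rw [lintegral_image_eq_lintegral_abs_det_fderiv_mul μ hA
    (fun x _ => (hasFDerivAt_shear (hη.differentiable one_ne_zero x)).hasFDerivWithinAt)
    (shear_bijective hM he ht).injective.injOn]
  simp only [det_id_add_smulRight_fderiv, abs_of_nonneg (shearJacobian_nonneg hM he ht _)]

end Lipschitz

theorem shearJacobian_of_eventuallyEq_zero {x : V} (h : η =ᶠ[𝓝 x] 0) :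
    shearJacobian η e t x = 1 := by
  simp [shearJacobian, h.fderiv_eq]

end Shear

/-! ### The second variation of the nonlocal perimeter -/

section ShearKernel

variable {n : ℕ} {K η : Rn n → ℝ} {e : Rn n} {t : ℝ}

/-- The kernel `K(x - y)` pulled back by a shear, including the Jacobian determinants. -/
noncomputable def shearKernel (K η : Rn n → ℝ) (e : Rn n) (t : ℝ) (p : Rn n × Rn n) : ℝ :=
  K (shear η e t p.1 - shear η e t p.2) * (shearJacobian η e t p.1 * shearJacobian η e t p.2)

theorem measurable_shearKernel (hK : Measurable K) (hη : ContDiff ℝ 1 η) :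
    Measurable (shearKernel K η e t) := by
  have hJ := (continuous_shearJacobian (e := e) (t := t) hη).measurable
  have hS := (continuous_shear (e := e) (t := t) hη.continuous).measurable
  exact (hK.comp ((hS.comp measurable_fst).sub (hS.comp measurable_snd))).mul
    ((hJ.comp measurable_fst).mul (hJ.comp measurable_snd))

theorem shearKernel_of_eventuallyEq_zero {x y : Rn n} (hx : η =ᶠ[𝓝 x] 0) (hy : η =ᶠ[𝓝 y] 0) :
    shearKernel K η e t (x, y) = K (x - y) := by
  simp [shearKernel, shearJacobian_of_eventuallyEq_zero, hx, hy, shear_of_eq_zero, hx.eq_of_nhds,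
    hy.eq_of_nhds]

variable {M : ℝ≥0} (hM : LipschitzWith M η) (he : ‖e‖ = 1) (ht : |t| * M ≤ 1 / 2)
include hM he ht

theorem interaction_shear (hη : ContDiff ℝ 1 η) {A B : Set (Rn n)} (hA : MeasurableSet A)
    (hB : MeasurableSet B) :
    interaction K (shear η e t '' A) (shear η e t '' B) =
      ∫⁻ x in A, ∫⁻ y in B, ENNReal.ofReal (shearKernel K η e t (x, y)) := by
  unfold interaction
  rw [setLIntegral_shear_image hM he ht volume hη hA]
  refine lintegral_congr fun x => ?_
  rw [setLIntegral_shear_image hM he ht volume hη hB,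
    ← lintegral_const_mul' _ _ ENNReal.ofReal_ne_top]
  refine lintegral_congr fun y => ?_
  rw [← ENNReal.ofReal_mul (shearJacobian_nonneg hM he ht y),
    ← ENNReal.ofReal_mul (shearJacobian_nonneg hM he ht x), shearKernel]
  ring_nf

theorem kPerimeter_shear (hK : Measurable K) (hη : ContDiff ℝ 1 η) {Ω E : Set (Rn n)}
    (hΩ : MeasurableSet Ω) (hηΩ : ∀ x ∉ Ω, η x = 0) (hE : MeasurableSet E) :
    kPerimeter K Ω (shear η e t '' E) =
      ∫⁻ p in crossing Ω E, ENNReal.ofReal (shearKernel K η e t p) := by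
  have hbij := shear_bijective hM he ht
  have hinter (A : Set (Rn n)) : shear η e t '' A ∩ Ω = shear η e t '' (A ∩ Ω) := by
    rw [image_inter hbij.injective, shear_image_eq_self hM he ht hηΩ]
  have hdiff (A : Set (Rn n)) : shear η e t '' A \ Ω = shear η e t '' (A \ Ω) := by
    rw [image_sdiff hbij.injective, shear_image_eq_self hM he ht hηΩ]
  rw [kPerimeter, ← image_compl_eq hbij, hinter, hinter, hdiff, hdiff,
    interaction_shear hM he ht hη (hE.inter hΩ) (hE.compl.inter hΩ),
    interaction_shear hM he ht hη (hE.inter hΩ) (hE.compl.diff hΩ),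
    interaction_shear hM he ht hη (hE.diff hΩ) (hE.compl.inter hΩ)]
  exact (setLIntegral_crossing hΩ hE (measurable_shearKernel hK hη).ennreal_ofReal).symm

variable {s lam Lam : ℝ} (hK : KernelClassL2 s lam Lam K) (hlam : 0 < lam)
include hK hlam

theorem shearKernel_nonneg {x y : Rn n} (hxy : x ≠ y) : 0 ≤ shearKernel K η e t (x, y) :=
  mul_nonneg (hK.pos hlam (sub_ne_zero.2 ((shear_bijective hM he ht).injective.ne hxy))).le
    (mul_nonneg (shearJacobian_nonneg hM he ht x) (shearJacobian_nonneg hM he ht y))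

variable (hs : 0 < s)
include hs

theorem shearKernel_add_le {x y : Rn n} (hxy : x ≠ y) :
    ENNReal.ofReal (shearKernel K η e t (x, y)) + ENNReal.ofReal (shearKernel K η e (-t) (x, y)) ≤
      2 * ENNReal.ofReal (K (x - y)) + ENNReal.ofReal (32 * harnackConst n s lam Lam *
        (|t| * M) ^ 2) * ENNReal.ofReal (K (x - y)) := by
  have hz := sub_ne_zero.2 hxy
  have hA := hK.one_le_harnackConst hs hlam hz
  have ht' : |-t| * M ≤ 1 / 2 := by rwa [abs_neg]
  have hrhs : ENNReal.ofReal ((2 + 32 * harnackConst n s lam Lam * (|t| * M) ^ 2) * K (x - y)) =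
      2 * ENNReal.ofReal (K (x - y)) + ENNReal.ofReal (32 * harnackConst n s lam Lam *
        (|t| * M) ^ 2) * ENNReal.ofReal (K (x - y)) := by
    rw [ENNReal.ofReal_mul (by positivity), ENNReal.ofReal_add zero_le_two (by positivity),
      ENNReal.ofReal_ofNat, add_mul]
  rw [← ENNReal.ofReal_add (shearKernel_nonneg hM he ht hK hlam hxy)
    (shearKernel_nonneg hM he ht' hK hlam hxy), ← hrhs]
  refine ENNReal.ofReal_le_ofReal ?_
  have key := hK.symmetric_deformation_le hs hlam hz he ht
    (abs_mul_sub_le_of_lipschitzWith hM t x y) (abs_mul_fderiv_apply_le hM he x)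
    (abs_mul_fderiv_apply_le hM he y)
  simpa only [shearKernel, shearJacobian, shear_sub_shear, neg_mul, neg_smul, ← sub_eq_add_neg]
    using key

theorem kPerimeter_shear_add_le (hη : ContDiff ℝ 1 η) {Ω Ω' E : Set (Rn n)}
    (hΩ : MeasurableSet Ω) (hΩ' : MeasurableSet Ω') (hηΩ : tsupport η ⊆ Ω)
    (hηΩ' : tsupport η ⊆ Ω') (hE : MeasurableSet E) :
    kPerimeter K Ω (shear η e t '' E) + kPerimeter K Ω (shear η e (-t) '' E) ≤
      2 * kPerimeter K Ω E + ENNReal.ofReal (32 * harnackConst n s lam Lam * (|t| * M) ^ 2) *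
        kPerimeter K Ω' E := by
  have hKm := hK.measurable hs hlam
  have ht' : |-t| * M ≤ 1 / 2 := by rwa [abs_neg]
  have hη0 : ∀ x ∉ Ω, η x = 0 := fun x hx => image_eq_zero_of_notMem_tsupport fun h => hx (hηΩ h)
  set c := ENNReal.ofReal (32 * harnackConst n s lam Lam * (|t| * M) ^ 2)
  let k : Rn n × Rn n → ℝ≥0∞ := fun p => ENNReal.ofReal (K (p.1 - p.2))
  have hk : Measurable k := measurable_kernel_sub hKm
  have hloc : ∀ x ∉ Ω', η =ᶠ[𝓝 x] 0 := fun x hx =>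
    notMem_tsupport_iff_eventuallyEq.1 fun h => hx (hηΩ' h)
  have hpt : ∀ p ∈ crossing Ω E, ENNReal.ofReal (shearKernel K η e t p) +
      ENNReal.ofReal (shearKernel K η e (-t) p) ≤
        2 * k p + (crossing Ω' E).indicator (fun p => c * k p) p := by
    rintro ⟨x, y⟩ hp
    by_cases hq : (x, y) ∈ crossing Ω' E
    · rw [indicator_of_mem hq]
      exact shearKernel_add_le hM he ht hK hlam hs fun h => hp.1.2 (h ▸ hp.1.1)
    · obtain ⟨hx, hy⟩ : x ∉ Ω' ∧ y ∉ Ω' := not_not.1 fun h => hq ⟨hp.1, h⟩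
      rw [indicator_of_notMem hq, add_zero, two_mul]
      simp only [shearKernel_of_eventuallyEq_zero (hloc x hx) (hloc y hy)]
      exact le_rfl
  calc kPerimeter K Ω (shear η e t '' E) + kPerimeter K Ω (shear η e (-t) '' E)
      = ∫⁻ p in crossing Ω E, (ENNReal.ofReal (shearKernel K η e t p) +
          ENNReal.ofReal (shearKernel K η e (-t) p)) := by
        rw [kPerimeter_shear hM he ht hKm hη hΩ hη0 hE, kPerimeter_shear hM he ht' hKm hη hΩ hη0 hE,
          lintegral_add_left (measurable_shearKernel hKm hη).ennreal_ofReal]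
    _ ≤ ∫⁻ p in crossing Ω E, (2 * k p + (crossing Ω' E).indicator (fun p => c * k p) p) :=
        setLIntegral_mono' (measurableSet_crossing hΩ hE) hpt
    _ = 2 * (∫⁻ p in crossing Ω E, k p) +
          ∫⁻ p in crossing Ω E, (crossing Ω' E).indicator (fun p => c * k p) p := by
        rw [lintegral_add_left (hk.const_mul 2), lintegral_const_mul _ hk]
    _ ≤ 2 * (∫⁻ p in crossing Ω E, k p) + c * ∫⁻ p in crossing Ω' E, k p := by
        rw [← lintegral_const_mul c hk, ← lintegral_indicator (measurableSet_crossing hΩ' hE)]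
        exact add_le_add_right (setLIntegral_le_lintegral _ _) _
    _ = 2 * kPerimeter K Ω E + c * kPerimeter K Ω' E := by
        rw [kPerimeter_eq_setLIntegral hKm hΩ hE, kPerimeter_eq_setLIntegral hKm hΩ' hE]

end ShearKernel

/-! ### Submodularity -/

section Submodularity

theorem measure_crossing_union_add_inter_add_le {α : Type*} [MeasurableSpace α]
    (ν : Measure (α × α)) {Ω E F : Set α} (hΩ : MeasurableSet Ω) (hE : MeasurableSet E)
    (hF : MeasurableSet F) (hFE : F \ E ⊆ Ω) :
    ν (crossing Ω (F ∪ E)) + ν (crossing Ω (F ∩ E)) + ν ((F \ E) ×ˢ (E \ F)) ≤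
      ν (crossing Ω E) + ν (crossing Ω F) := by
  set U := crossing Ω (F ∪ E)
  set I := crossing Ω (F ∩ E)
  set D := (F \ E) ×ˢ (E \ F)
  have hI : MeasurableSet I := measurableSet_crossing hΩ (hF.inter hE)
  have hD : MeasurableSet D := (hF.diff hE).prod (hE.diff hF)
  have hdisj : Disjoint (U ∪ I) D := by
    refine disjoint_left.2 ?_
    rintro ⟨x, y⟩ (h | h) h'
    · exact h.1.2 (Or.inr h'.2.1)
    · exact h'.1.2 h.1.1.2
  have hunion : U ∪ I ∪ D ⊆ crossing Ω E ∪ crossing Ω F := by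
    rintro ⟨x, y⟩ hxy
    have hx : x ∈ F → x ∉ E → x ∈ Ω := fun h h' => hFE ⟨h, h'⟩
    simp only [U, I, D, crossing, mem_union, Set.mem_sdiff, mem_prod, mem_compl_iff,
      mem_inter_iff] at hxy ⊢
    tauto
  have hinter : U ∩ I ⊆ crossing Ω E ∩ crossing Ω F := fun p hp =>
    ⟨⟨⟨hp.2.1.1.2, fun h => hp.1.1.2 (Or.inr h)⟩, hp.1.2⟩,
      ⟨⟨hp.2.1.1.1, fun h => hp.1.1.2 (Or.inl h)⟩, hp.1.2⟩⟩
  calc ν U + ν I + ν D = ν (U ∪ I ∪ D) + ν (U ∩ I) := by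
        rw [measure_union hdisj hD, ← measure_union_add_inter U hI]
        ring
    _ ≤ ν (crossing Ω E ∪ crossing Ω F) + ν (crossing Ω E ∩ crossing Ω F) :=
        add_le_add (measure_mono hunion) (measure_mono hinter)
    _ = ν (crossing Ω E) + ν (crossing Ω F) :=
        measure_union_add_inter _ (measurableSet_crossing hΩ hF)

variable {n : ℕ} {K : Rn n → ℝ} {Ω E F : Set (Rn n)}

theorem interaction_eq_setLIntegral (hK : Measurable K) (A B : Set (Rn n)) :
    interaction K A B = ∫⁻ p in A ×ˢ B, ENNReal.ofReal (K (p.1 - p.2)) :=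
  (setLIntegral_prod _ (measurable_kernel_sub hK).aemeasurable.restrict).symm

theorem kPerimeter_union_add_inter_add_le (hK : Measurable K) (hΩ : MeasurableSet Ω)
    (hE : MeasurableSet E) (hF : MeasurableSet F) (hFE : F \ E ⊆ Ω) :
    kPerimeter K Ω (F ∪ E) + kPerimeter K Ω (F ∩ E) + interaction K (F \ E) (E \ F) ≤
      kPerimeter K Ω E + kPerimeter K Ω F := by
  have h := measure_crossing_union_add_inter_add_le
    (volume.withDensity fun p => ENNReal.ofReal (K (p.1 - p.2))) hΩ hE hF hFE
  rwa [withDensity_apply _ (measurableSet_crossing hΩ (hF.union hE)),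
    withDensity_apply _ (measurableSet_crossing hΩ (hF.inter hE)),
    withDensity_apply _ (measurableSet_crossing hΩ hE),
    withDensity_apply _ (measurableSet_crossing hΩ hF),
    withDensity_apply _ ((hF.diff hE).prod (hE.diff hF)),
    ← kPerimeter_eq_setLIntegral hK hΩ (hF.union hE),
    ← kPerimeter_eq_setLIntegral hK hΩ (hF.inter hE), ← kPerimeter_eq_setLIntegral hK hΩ hE,
    ← kPerimeter_eq_setLIntegral hK hΩ hF, ← interaction_eq_setLIntegral hK] at h

theorem kPerimeter_add_interaction_le (hK : Measurable K) (hΩ : MeasurableSet Ω)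
    (hE : MeasurableSet E) (hF : MeasurableSet F) (hFE : F \ E ⊆ Ω) (hfin : kPerimeter K Ω E < ∞)
    {δ : ℝ≥0∞} (hunion : kPerimeter K Ω E ≤ kPerimeter K Ω (F ∪ E) + δ)
    (hinter : kPerimeter K Ω E ≤ kPerimeter K Ω (F ∩ E) + δ) :
    kPerimeter K Ω E + interaction K (F \ E) (E \ F) ≤ kPerimeter K Ω F + 2 * δ := by
  refine (ENNReal.add_le_add_iff_left hfin.ne).1 ?_
  calc kPerimeter K Ω E + (kPerimeter K Ω E + interaction K (F \ E) (E \ F))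
      ≤ (kPerimeter K Ω (F ∪ E) + δ) +
          (kPerimeter K Ω (F ∩ E) + δ + interaction K (F \ E) (E \ F)) := by gcongr
    _ = kPerimeter K Ω (F ∪ E) + kPerimeter K Ω (F ∩ E) + interaction K (F \ E) (E \ F)
          + 2 * δ := by ring
    _ ≤ kPerimeter K Ω E + kPerimeter K Ω F + 2 * δ := by
        exact add_le_add_left (kPerimeter_union_add_inter_add_le hK hΩ hE hF hFE) _
    _ = kPerimeter K Ω E + (kPerimeter K Ω F + 2 * δ) := add_assoc _ _ _

end Submodularity

/-! ### Stability under shears -/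

section Stability

variable {n : ℕ} {K : Rn n → ℝ} {Ω E E' : Set (Rn n)}

theorem interaction_congr_ae {A A' B B' : Set (Rn n)} (hA : A =ᵐ[volume] A')
    (hB : B =ᵐ[volume] B') : interaction K A B = interaction K A' B' := by
  unfold interaction
  rw [Measure.restrict_congr_set hA, Measure.restrict_congr_set hB]

theorem kPerimeter_congr_ae (h : E =ᵐ[volume] E') : kPerimeter K Ω E = kPerimeter K Ω E' := by
  have hin := h.inter (ae_eq_refl Ω)
  have hcin := h.compl.inter (ae_eq_refl Ω)
  unfold kPerimeter
  rw [interaction_congr_ae hin hcin, interaction_congr_ae hin (h.compl.diff (ae_eq_refl Ω)),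
    interaction_congr_ae (h.diff (ae_eq_refl Ω)) hcin]

theorem shear_image_congr_ae {V : Type*} [NormedAddCommGroup V] [NormedSpace ℝ V]
    [FiniteDimensional ℝ V] [MeasurableSpace V] [BorelSpace V] {μ : Measure V}
    [μ.IsAddHaarMeasure] {η : V → ℝ} (hη : Differentiable ℝ η) (e : V) (t : ℝ) {E E' : Set V}
    (h : E =ᵐ[μ] E') : (shear η e t '' E : Set V) =ᵐ[μ] (shear η e t '' E' : Set V) := by
  have hd : Differentiable ℝ (shear η e t) := fun x => (hasFDerivAt_shear (hη x)).differentiableAt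
  have hnull : ∀ A B : Set V, μ (A \ B) = 0 → μ (shear η e t '' A \ shear η e t '' B) = 0 := by
    refine fun A B hAB => measure_mono_null (t := shear η e t '' (A \ B)) ?_
      (addHaar_image_eq_zero_of_differentiableOn_of_addHaar_eq_zero μ hd.differentiableOn hAB)
    rw [sdiff_subset_iff, ← image_union, union_sdiff_self]
    exact image_mono subset_union_right
  rw [ae_eq_set] at h ⊢
  exact ⟨hnull _ _ h.1, hnull _ _ h.2⟩

/-- Stability tested only on the deformations `shear η e t` with `η ∈ C²_c(Ω)`. Unlike
`IsStableSet`, it does not involve flows. -/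
def IsShearStable (K : Rn n → ℝ) (Ω E : Set (Rn n)) : Prop :=
  kPerimeter K Ω E < ∞ ∧
  ∀ (η : Rn n → ℝ) (e : Rn n), ContDiff ℝ 2 η → HasCompactSupport η → tsupport η ⊆ Ω →
    ∀ ε : ℝ, 0 < ε → ∀ᶠ t in 𝓝 (0 : ℝ),
      kPerimeter K Ω E ≤
        kPerimeter K Ω (shear η e t '' E ∪ E) + ENNReal.ofReal (ε * t ^ 2) ∧
      kPerimeter K Ω E ≤ kPerimeter K Ω (shear η e t '' E ∩ E) + ENNReal.ofReal (ε * t ^ 2)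

theorem IsStableSet.isShearStable (hE : IsStableSet K Ω E) : IsShearStable K Ω E := by
  refine ⟨hE.1, fun η e hη hηc hηΩ ε hε => ?_⟩
  have hsupp : tsupport (fun x => η x • e) ⊆ tsupport η := tsupport_smul_subset_left _ _
  obtain ⟨c, hc, X, Ψ, hX, hΨ, hflow⟩ := exists_admissible_flow (hη.smul contDiff_const)
    (hηc.smul_right (f' := fun _ => e)) (hsupp.trans hηΩ)
  obtain ⟨t₀, ht₀, h⟩ := hE.2 X hX Ψ hΨ (ε * c ^ 2) (by positivity)
  have hscale : Tendsto (fun t : ℝ => t / c) (𝓝 0) (𝓝 0) :=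
    (continuous_id.div_const c).tendsto' _ _ (zero_div c)
  filter_upwards [hscale.eventually (Ioo_mem_nhds (neg_lt_zero.2 ht₀) ht₀),
    hscale.eventually (Metric.closedBall_mem_nhds 0 (by norm_num : (0 : ℝ) < 1 / 4))]
    with t ht ht'
  have himage : Ψ (t / c) = shear η e t := by
    funext x
    rw [hflow _ (by rwa [← Real.norm_eq_abs, ← mem_closedBall_zero_iff]),
      mul_div_cancel₀ _ hc.ne', shear, mul_smul]
    rfl
  have hε : ε * c ^ 2 * (t / c) ^ 2 = ε * t ^ 2 := by field_simp
  simpa only [himage, hε] using h (t / c) ht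

theorem IsShearStable.congr_ae (hE : IsShearStable K Ω E) (h : E =ᵐ[volume] E') :
    IsShearStable K Ω E' := by
  refine ⟨kPerimeter_congr_ae (K := K) h ▸ hE.1, fun η e hη hηc hηΩ ε hε => ?_⟩
  filter_upwards [hE.2 η e hη hηc hηΩ ε hε] with t ht
  have hF := shear_image_congr_ae (hη.differentiable two_ne_zero) e t h
  rwa [← kPerimeter_congr_ae h, ← kPerimeter_congr_ae (hF.union h),
    ← kPerimeter_congr_ae (hF.inter h)]

theorem eventually_abs_mul_le_half (M : ℝ) : ∀ᶠ t in 𝓝 (0 : ℝ), |t| * M ≤ 1 / 2 := by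
  have h : Tendsto (fun t : ℝ => |t| * M) (𝓝 0) (𝓝 0) :=
    (continuous_abs.mul_const M).tendsto' _ _ (by rw [abs_zero, zero_mul])
  exact h.eventually (Iic_mem_nhds one_half_pos)

/-- Comparing `E` with both `shear η e t '' E` and `shear η e (-t) '' E` cancels the first-order
terms, so that the interaction is of second order in `t`. -/
theorem IsShearStable.eventually_interaction_le {s lam Lam : ℝ} (hE : IsShearStable K Ω E)
    (hK : KernelClassL2 s lam Lam K) (hs : 0 < s) (hlam : 0 < lam) (hΩ : MeasurableSet Ω)
    (hEm : MeasurableSet E) {η : Rn n → ℝ} {e : Rn n} {M : ℝ≥0} (hη : ContDiff ℝ 2 η)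
    (hηc : HasCompactSupport η) (hηΩ : tsupport η ⊆ Ω) {Ω' : Set (Rn n)}
    (hΩ' : MeasurableSet Ω') (hηΩ' : tsupport η ⊆ Ω') (hM : LipschitzWith M η) (he : ‖e‖ = 1)
    {ε : ℝ} (hε : 0 < ε) :
    ∀ᶠ t in 𝓝 (0 : ℝ), interaction K (shear η e t '' E \ E) (E \ shear η e t '' E) ≤
      ENNReal.ofReal (32 * harnackConst n s lam Lam * (|t| * M) ^ 2) * kPerimeter K Ω' E +
        4 * ENNReal.ofReal (ε * t ^ 2) := by
  have hKm := hK.measurable hs hlam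
  have hone : ∀ᶠ t in 𝓝 (0 : ℝ), kPerimeter K Ω E +
      interaction K (shear η e t '' E \ E) (E \ shear η e t '' E) ≤
        kPerimeter K Ω (shear η e t '' E) + 2 * ENNReal.ofReal (ε * t ^ 2) := by
    filter_upwards [hE.2 η e hη hηc hηΩ ε hε, eventually_abs_mul_le_half M] with t hst ht
    have hFm : MeasurableSet (shear η e t '' E) := hEm.image_of_continuousOn_injOn
      (continuous_shear hη.continuous).continuousOn (shear_bijective hM he ht).injective.injOn
    refine kPerimeter_add_interaction_le hKm hΩ hEm hFm ?_ hE.1 hst.1 hst.2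
    rintro _ ⟨⟨x, hx, rfl⟩, hxE⟩
    have hxη : x ∈ tsupport η := by
      by_contra h
      exact hxE (by rwa [shear_of_eq_zero (image_eq_zero_of_notMem_tsupport h)])
    have hinv := shear_image_eq_self hM he ht (Ω := Ω)
      fun y hy => image_eq_zero_of_notMem_tsupport fun h => hy (hηΩ h)
    exact hinv ▸ mem_image_of_mem _ (hηΩ hxη)
  have hneg : Tendsto (fun t : ℝ => -t) (𝓝 0) (𝓝 0) := continuous_neg.tendsto' _ _ neg_zero
  filter_upwards [hone, hneg.eventually hone, eventually_abs_mul_le_half M] with t hpos hneg ht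
  have hsum := kPerimeter_shear_add_le hM he ht hK hlam hs (hη.of_le one_le_two) hΩ hΩ' hηΩ hηΩ' hEm
  rw [neg_sq] at hneg
  have hfin : 2 * kPerimeter K Ω E ≠ ∞ := ENNReal.mul_ne_top ENNReal.ofNat_ne_top hE.1.ne
  set δ := ENNReal.ofReal (ε * t ^ 2)
  set D := interaction K (shear η e t '' E \ E) (E \ shear η e t '' E)
  refine (ENNReal.add_le_add_iff_left hfin).1 ?_
  calc 2 * kPerimeter K Ω E + D = kPerimeter K Ω E + D + kPerimeter K Ω E := by ring
    _ ≤ (kPerimeter K Ω (shear η e t '' E) + 2 * δ) +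
          (kPerimeter K Ω (shear η e (-t) '' E) + 2 * δ) :=
        add_le_add hpos (le_self_add.trans hneg)
    _ = (kPerimeter K Ω (shear η e t '' E) + kPerimeter K Ω (shear η e (-t) '' E)) + 4 * δ := by
        ring
    _ ≤ _ := add_le_add_left hsum _
    _ = _ := add_assoc _ _ _

end Stability

/-! ### Jump sets -/

section JumpSet

variable {V : Type*} [NormedAddCommGroup V]

/-- The points `x ∈ U` with `x + h ∈ U` that the set `E` separates from `x + h`. The growth of its
measure in `h` controls the variation of `E` in `U`. -/
def jumpSet (U E : Set V) (h : V) : Set V := {x | x ∈ U ∧ x + h ∈ U ∧ ¬(x ∈ E ↔ x + h ∈ E)}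

theorem jumpSet_zero (U E : Set V) : jumpSet U E 0 = ∅ := by
  simp [jumpSet]

theorem jumpSet_mono {U U' : Set V} (hU : U ⊆ U') (E : Set V) (h : V) :
    jumpSet U E h ⊆ jumpSet U' E h := fun _ hx => ⟨hU hx.1, hU hx.2.1, hx.2.2⟩

theorem jumpSet_subset_symmDiff (U E : Set V) (h : V) :
    jumpSet U E h ⊆ symmDiff (U ∩ (· + h) ⁻¹' E) (U ∩ E) := by
  rintro x ⟨hx, -, hne⟩
  simp only [mem_symmDiff, mem_inter_iff, mem_preimage]
  tauto

theorem jumpSet_add_subset {U : Set V} (E : Set V) {h k : V}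
    (hU : ∀ x ∈ U, x + (h + k) ∈ U → x + h ∈ U) :
    jumpSet U E (h + k) ⊆ jumpSet U E h ∪ (· + h) ⁻¹' jumpSet U E k := by
  rintro x ⟨hx, hxhk, hne⟩
  have hxh := hU x hx hxhk
  rw [← add_assoc] at hxhk hne
  by_cases hE : x ∈ E ↔ x + h ∈ E
  · exact Or.inr ⟨hxh, hxhk, fun h' => hne (hE.trans h')⟩
  · exact Or.inl ⟨hx, hxh, hE⟩

variable [MeasurableSpace V] {μ : Measure V} {U E : Set V}

/-- The measure of the jump set in `U` grows at most linearly, with slope `v`. -/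
def HasJumpBound (μ : Measure V) (U E : Set V) (v : ℝ) : Prop :=
  ∀ h, μ (jumpSet U E h) ≤ ENNReal.ofReal (v * ‖h‖)

theorem HasJumpBound.mono {v v' : ℝ} (hE : HasJumpBound μ U E v) (hv : v ≤ v') :
    HasJumpBound μ U E v' := fun h =>
  (hE h).trans (ENNReal.ofReal_le_ofReal (mul_le_mul_of_nonneg_right hv (norm_nonneg h)))

theorem HasJumpBound.anti_set {U' : Set V} {v : ℝ} (hE : HasJumpBound μ U E v) (hU : U' ⊆ U) :
    HasJumpBound μ U' E v := fun h => (measure_mono (jumpSet_mono hU E h)).trans (hE h)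

variable [NormedSpace ℝ V] [BorelSpace V] [μ.IsAddRightInvariant]

theorem measure_jumpSet_nsmul_le (hU : Convex ℝ U) (E : Set V) (h : V) (N : ℕ) :
    μ (jumpSet U E (N • h)) ≤ N * μ (jumpSet U E h) := by
  induction N with
  | zero => simp [jumpSet_zero]
  | succ N ih =>
    have hmid : ∀ x ∈ U, x + (N • h + h) ∈ U → x + N • h ∈ U := by
      intro x hx hxN
      have hratio : (N : ℝ) / (N + 1) ∈ Icc (0 : ℝ) 1 :=
        ⟨by positivity, div_le_one_of_le₀ (by linarith) (by positivity)⟩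
      convert hU.add_smul_mem hx hxN hratio using 2
      rw [← Nat.cast_smul_eq_nsmul ℝ]
      match_scalars
      field_simp
    calc μ (jumpSet U E ((N + 1) • h))
        ≤ μ (jumpSet U E (N • h)) + μ ((· + N • h) ⁻¹' jumpSet U E h) := by
          rw [succ_nsmul]
          exact (measure_mono (jumpSet_add_subset E hmid)).trans (measure_union_le _ _)
      _ ≤ N * μ (jumpSet U E h) + μ (jumpSet U E h) := by
          rw [measure_preimage_add_right]
          gcongr
      _ = (N + 1 : ℕ) * μ (jumpSet U E h) := by
          push_cast
          ring

theorem measure_jumpSet_smul_le_of_eventually (hU : Convex ℝ U) {e : V} {v : ℝ}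
    (hsmall : ∀ᶠ t in 𝓝[>] (0 : ℝ), μ (jumpSet U E (t • e)) ≤ ENNReal.ofReal (v * t)) {σ : ℝ}
    (hσ : 0 < σ) : μ (jumpSet U E (σ • e)) ≤ ENNReal.ofReal (v * σ) := by
  have hlim : Tendsto (fun N : ℕ => σ / ((N + 1 : ℕ) : ℝ)) atTop (𝓝[>] 0) :=
    tendsto_nhdsWithin_iff.2 ⟨
      (tendsto_const_div_atTop_nhds_zero_nat σ).comp (tendsto_add_atTop_nat 1),
      Eventually.of_forall fun N => by simp only [mem_Ioi]; positivity⟩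
  obtain ⟨N, hN⟩ := (hlim.eventually hsmall).exists
  have hN0 : (0 : ℝ) < (N + 1 : ℕ) := by positivity
  calc μ (jumpSet U E (σ • e)) = μ (jumpSet U E ((N + 1) • (σ / (N + 1 : ℕ)) • e)) := by
        rw [← Nat.cast_smul_eq_nsmul ℝ, smul_smul, mul_div_cancel₀ _ hN0.ne']
    _ ≤ (N + 1 : ℕ) * ENNReal.ofReal (v * (σ / (N + 1 : ℕ))) :=
        (measure_jumpSet_nsmul_le hU E _ _).trans (by gcongr)
    _ = ENNReal.ofReal (v * σ) := by
        rw [← ENNReal.ofReal_natCast, ← ENNReal.ofReal_mul hN0.le]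
        congr 1
        field_simp

theorem hasJumpBound_of_eventually (hU : Convex ℝ U) {v : ℝ}
    (hsmall : ∀ e : V, ‖e‖ = 1 →
      ∀ᶠ t in 𝓝[>] (0 : ℝ), μ (jumpSet U E (t • e)) ≤ ENNReal.ofReal (v * t)) :
    HasJumpBound μ U E v := by
  intro h
  rcases eq_or_ne h 0 with rfl | hh
  · simp [jumpSet_zero]
  · have hscale : ‖h‖ • (‖h‖⁻¹ • h) = h := smul_inv_smul₀ (norm_ne_zero_iff.2 hh) h
    simpa only [hscale] using measure_jumpSet_smul_le_of_eventually hU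
      (hsmall (‖h‖⁻¹ • h) (norm_smul_inv_norm (𝕜 := ℝ) hh)) (norm_pos_iff.2 hh)

end JumpSet

/-! ### Symmetric differences and translations -/

section Translation

theorem measureReal_symmDiff_sq {α : Type*} [MeasurableSpace α] {μ : Measure α} {A B : Set α}
    (hA : MeasurableSet A) (hB : MeasurableSet B) (hAμ : μ A ≠ ∞) (hBμ : μ B ≠ ∞) :
    μ.real (symmDiff A B) ^ 2 =
      (μ.real A - μ.real B) ^ 2 + 4 * (μ.real (A \ B) * μ.real (B \ A)) := by
  have hA' := measureReal_sdiff_add_inter (μ := μ) hB hAμ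
  have hB' := measureReal_sdiff_add_inter (μ := μ) hA hBμ
  rw [inter_comm] at hB'
  rw [measureReal_symmDiff_eq hA hB, ← hA', ← hB']
  ring

variable {V : Type*} [NormedAddCommGroup V] [NormedSpace ℝ V] [MeasurableSpace V] [BorelSpace V]
  [FiniteDimensional ℝ V] (μ : Measure V) [μ.IsAddHaarMeasure]

open Module in
/-- The constant for which shells of outer radius at most `R` have measure at most
`shellConst μ R` times their width. -/
noncomputable def shellConst (R : ℝ) : ℝ :=
  finrank ℝ V * R ^ (finrank ℝ V - 1) * μ.real (Metric.ball 0 1)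

theorem measureReal_ball_diff_ball_le {x y : V} {r R : ℝ} (hr : 0 < r)
    (hR : r + dist x y ≤ R) :
    μ.real (Metric.ball x r \ Metric.ball y r) ≤ shellConst μ R * dist x y := by
  set d := Module.finrank ℝ V
  have hxy := dist_nonneg (x := x) (y := y)
  have hsub : Metric.ball x r ⊆ Metric.ball y (r + dist x y) := Metric.ball_subset_ball' le_rfl
  have hball : ∀ ρ, 0 < ρ → μ.real (Metric.ball y ρ) = ρ ^ d * μ.real (Metric.ball 0 1) := by
    intro ρ hρ
    rw [measureReal_def, Measure.addHaar_ball_of_pos μ y hρ, ENNReal.toReal_mul,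
      ENNReal.toReal_ofReal (pow_nonneg hρ.le d), measureReal_def]
  have hpow : (r + dist x y) ^ d - r ^ d ≤ dist x y * d * R ^ (d - 1) := by
    have h := abs_pow_sub_pow_le (r + dist x y) r d
    rw [add_sub_cancel_left, abs_of_nonneg hxy, abs_of_nonneg (add_nonneg hr.le hxy),
      abs_of_nonneg hr.le, max_eq_left (le_add_of_nonneg_right hxy)] at h
    exact (le_abs_self _).trans (h.trans (by gcongr))
  calc μ.real (Metric.ball x r \ Metric.ball y r)
      ≤ μ.real (Metric.ball y (r + dist x y) \ Metric.ball y r) :=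
        measureReal_mono (sdiff_subset_sdiff_left hsub)
          (measure_ne_top_of_subset sdiff_subset measure_ball_lt_top.ne)
    _ = ((r + dist x y) ^ d - r ^ d) * μ.real (Metric.ball 0 1) := by
        rw [measureReal_sdiff (Metric.ball_subset_ball (le_add_of_nonneg_right hxy))
          measurableSet_ball, hball _ (add_pos_of_pos_of_nonneg hr hxy), hball r hr, sub_mul]
    _ ≤ dist x y * d * R ^ (d - 1) * μ.real (Metric.ball 0 1) := by gcongr
    _ = shellConst μ R * dist x y := by
        unfold shellConst
        ring

theorem measureReal_ball_inter_le (E : Set V) {x y : V} {r R : ℝ} (hr : 0 < r)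
    (hR : r + dist x y ≤ R) :
    μ.real (Metric.ball x r ∩ E) ≤ μ.real (Metric.ball y r ∩ E) + shellConst μ R * dist x y := by
  have hsub : Metric.ball x r ∩ E ⊆
      (Metric.ball y r ∩ E) ∪ (Metric.ball x r \ Metric.ball y r) := fun z hz => by
    by_cases hzy : z ∈ Metric.ball y r
    · exact Or.inl ⟨hzy, hz.2⟩
    · exact Or.inr ⟨hz.1, hzy⟩
  have hfin : μ ((Metric.ball y r ∩ E) ∪ (Metric.ball x r \ Metric.ball y r)) ≠ ∞ :=
    measure_union_ne_top (measure_ne_top_of_subset inter_subset_left measure_ball_lt_top.ne)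
      (measure_ne_top_of_subset sdiff_subset measure_ball_lt_top.ne)
  refine (measureReal_mono hsub hfin).trans ((measureReal_union_le _ _).trans ?_)
  gcongr
  exact measureReal_ball_diff_ball_le μ hr hR

theorem abs_measureReal_ball_inter_translate_sub_le (E : Set V) {r R : ℝ} {h : V}
    (hr : 0 < r) (hR : r + ‖h‖ ≤ R) :
    |μ.real (Metric.ball 0 r ∩ (· + h) ⁻¹' E) - μ.real (Metric.ball 0 r ∩ E)| ≤
      shellConst μ R * ‖h‖ := by
  have htranslate : μ.real (Metric.ball 0 r ∩ (· + h) ⁻¹' E) = μ.real (Metric.ball h r ∩ E) := by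
    have hball : Metric.ball (0 : V) r = (· + h) ⁻¹' Metric.ball h r := by
      ext x
      simp
    rw [hball, ← preimage_inter, measureReal_def, measure_preimage_add_right, measureReal_def]
  have h₁ := measureReal_ball_inter_le μ E (x := h) (y := 0) (R := R) hr (by rwa [dist_zero_right])
  have h₂ := measureReal_ball_inter_le μ E (x := 0) (y := h) (R := R) hr (by rwa [dist_zero_left])
  rw [dist_zero_right] at h₁
  rw [dist_zero_left] at h₂
  rw [htranslate, abs_le]
  constructor <;> linarith

theorem measureReal_jumpSet_sq_le {E : Set V} (hE : MeasurableSet E) {r R : ℝ}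
    {h : V} (hr : 0 < r) (hR : r + ‖h‖ ≤ R) :
    μ.real (jumpSet (Metric.ball 0 r) E h) ^ 2 ≤ (shellConst μ R * ‖h‖) ^ 2 +
      4 * (μ.real ((Metric.ball 0 r ∩ (· + h) ⁻¹' E) \ (Metric.ball 0 r ∩ E)) *
        μ.real ((Metric.ball 0 r ∩ E) \ (Metric.ball 0 r ∩ (· + h) ⁻¹' E))) := by
  have hfin : ∀ S : Set V, μ (Metric.ball 0 r ∩ S) ≠ ∞ := fun S =>
    measure_ne_top_of_subset inter_subset_left measure_ball_lt_top.ne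
  have hEh : MeasurableSet ((· + h) ⁻¹' E) := hE.preimage (measurable_add_const h)
  calc μ.real (jumpSet (Metric.ball 0 r) E h) ^ 2
      ≤ μ.real (symmDiff (Metric.ball 0 r ∩ (· + h) ⁻¹' E) (Metric.ball 0 r ∩ E)) ^ 2 := by
        gcongr
        · exact measure_ne_top_of_subset symmDiff_subset_union
            (measure_union_ne_top (hfin _) (hfin _))
        · exact jumpSet_subset_symmDiff _ _ _
    _ ≤ _ := by
        rw [measureReal_symmDiff_sq (measurableSet_ball.inter hEh) (measurableSet_ball.inter hE)
          (hfin _) (hfin _)]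
        gcongr ?_ + _
        exact sq_le_sq' (abs_le.1 (abs_measureReal_ball_inter_translate_sub_le μ E hr hR)).1
          (abs_le.1 (abs_measureReal_ball_inter_translate_sub_le μ E hr hR)).2

end Translation

/-! ### Radial cutoff functions -/

section Cutoff

theorem exists_lipschitzWith_smoothTransition :
    ∃ L : ℝ≥0, LipschitzWith L Real.smoothTransition := by
  obtain ⟨L, hL⟩ := (Real.smoothTransition.contDiff (n := 1)).contDiffOn.exists_lipschitzOnWith
    one_ne_zero (convex_Icc (0 : ℝ) 1) isCompact_Icc
  refine ⟨L, LipschitzWith.of_dist_le_mul fun x y => ?_⟩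
  rw [← Real.smoothTransition.projIcc (x := x), ← Real.smoothTransition.projIcc (x := y)]
  refine (hL.dist_le_mul _ (projIcc 0 1 zero_le_one x).2 _ (projIcc 0 1 zero_le_one y).2).trans ?_
  gcongr
  have h := (LipschitzWith.projIcc (zero_le_one (α := ℝ))).dist_le_mul x y
  rwa [NNReal.coe_one, one_mul, Subtype.dist_eq] at h

variable {V : Type*} [NormedAddCommGroup V]

/-- A function of `‖x‖` equal to `1` for `‖x‖ ≤ ρ` and to `0` for `ρ' ≤ ‖x‖`. -/
noncomputable def radialCutoff (ρ ρ' : ℝ) (x : V) : ℝ :=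
  Real.smoothTransition ((ρ' - ‖x‖) / (ρ' - ρ))

variable {ρ ρ' : ℝ}

theorem radialCutoff_eq_one (h : ρ < ρ') {x : V} (hx : ‖x‖ ≤ ρ) : radialCutoff ρ ρ' x = 1 :=
  Real.smoothTransition.one_of_one_le ((one_le_div (sub_pos.2 h)).2 (by linarith))

theorem tsupport_radialCutoff_subset (h : ρ < ρ') :
    tsupport (radialCutoff ρ ρ' : V → ℝ) ⊆ Metric.closedBall 0 ρ' := by
  refine closure_minimal (fun x hx => ?_) Metric.isClosed_closedBall
  by_contra hx'
  rw [mem_closedBall_zero_iff, not_le] at hx'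
  exact hx (Real.smoothTransition.zero_of_nonpos
    (div_nonpos_of_nonpos_of_nonneg (by linarith) (by linarith)))

theorem lipschitzWith_radialCutoff {L : ℝ≥0} (hL : LipschitzWith L Real.smoothTransition)
    (h : ρ < ρ') : LipschitzWith (L / (ρ' - ρ).toNNReal) (radialCutoff ρ ρ' : V → ℝ) := by
  refine LipschitzWith.of_dist_le_mul fun x y => (hL.dist_le_mul _ _).trans ?_
  rw [Real.dist_eq, ← sub_div, sub_sub_sub_cancel_left, abs_div, abs_of_pos (sub_pos.2 h),
    NNReal.coe_div, Real.coe_toNNReal _ (sub_pos.2 h).le, dist_comm, dist_eq_norm,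
    div_mul_eq_mul_div, mul_div_assoc]
  gcongr
  exact abs_norm_sub_norm_le y x

theorem contDiff_radialCutoff {V : Type*} [NormedAddCommGroup V] [InnerProductSpace ℝ V]
    (hρ : 0 < ρ) (h : ρ < ρ') {k : ℕ∞} : ContDiff ℝ k (radialCutoff ρ ρ' : V → ℝ) := by
  refine contDiff_iff_contDiffAt.2 fun x => ?_
  rcases eq_or_ne x 0 with rfl | hx
  · refine (contDiffAt_const (c := (1 : ℝ))).congr_of_eventuallyEq ?_
    filter_upwards [Metric.closedBall_mem_nhds (0 : V) hρ] with y hy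
    exact radialCutoff_eq_one h (mem_closedBall_zero_iff.1 hy)
  · exact Real.smoothTransition.contDiffAt.comp x
      ((contDiffAt_const.sub (contDiffAt_norm ℝ hx)).div_const _)

theorem exists_contDiff_cutoff {V : Type*} [NormedAddCommGroup V] [InnerProductSpace ℝ V]
    {L : ℝ≥0} (hL : LipschitzWith L Real.smoothTransition) {r R : ℝ} (hr : 0 < r) (hrR : r < R) :
    ∃ (η : V → ℝ) (M : ℝ≥0), ContDiff ℝ 2 η ∧ tsupport η ⊆ Metric.ball 0 R ∧
      (∀ x, ‖x‖ ≤ r + (R - r) / 4 → η x = 1) ∧ LipschitzWith M η ∧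
      (M : ℝ) = L * 4 / (R - r) := by
  have hρ : r + (R - r) / 4 < r + (R - r) / 2 := by linarith
  refine ⟨_, _, contDiff_radialCutoff (k := 2) (by linarith) hρ,
    (tsupport_radialCutoff_subset hρ).trans (Metric.closedBall_subset_ball (by linarith)),
    fun x => radialCutoff_eq_one hρ, lipschitzWith_radialCutoff hL hρ, ?_⟩
  rw [NNReal.coe_div, Real.coe_toNNReal _ (sub_pos.2 hρ).le,
    show r + (R - r) / 2 - (r + (R - r) / 4) = (R - r) / 4 by ring, div_div_eq_mul_div]

end Cutoff

/-! ### From the nonlocal perimeter to jump bounds -/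

section PerimeterToJump

variable {n : ℕ} {s lam Lam : ℝ} {K : Rn n → ℝ}

theorem KernelClassL2.le_of_norm_le (hK : KernelClassL2 s lam Lam K) (hs : 0 < s) (hlam : 0 < lam)
    {z : Rn n} (hz : z ≠ 0) {R : ℝ} (hzR : ‖z‖ ≤ R) : lam / R ^ ((n : ℝ) + s) ≤ K z := by
  have : 0 < ‖z‖ := norm_pos_iff.2 hz
  refine le_trans ?_ (hK.lower z hz)
  gcongr

theorem ofReal_mul_volume_mul_volume_le_interaction {A B : Set (Rn n)} (hA : MeasurableSet A)
    (hB : MeasurableSet B) {c : ℝ} (hc : ∀ x ∈ A, ∀ y ∈ B, c ≤ K (x - y)) :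
    ENNReal.ofReal c * (volume A * volume B) ≤ interaction K A B := by
  have hinner : ∀ x ∈ A, ENNReal.ofReal c * volume B ≤ ∫⁻ y in B, ENNReal.ofReal (K (x - y)) := by
    intro x hx
    rw [← setLIntegral_const]
    exact setLIntegral_mono' hB fun y hy => ENNReal.ofReal_le_ofReal (hc x hx y hy)
  calc ENNReal.ofReal c * (volume A * volume B)
      = ∫⁻ _ in A, ENNReal.ofReal c * volume B := by rw [setLIntegral_const]; ring
    _ ≤ interaction K A B := setLIntegral_mono' hA hinner

theorem mul_volume_mul_volume_le {A B : Set (Rn n)} (hA : MeasurableSet A) (hB : MeasurableSet B)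
    (hAfin : volume A ≠ ∞) (hBfin : volume B ≠ ∞) {c D : ℝ} (hc₀ : 0 ≤ c)
    (hc : ∀ x ∈ A, ∀ y ∈ B, c ≤ K (x - y)) (hD₀ : 0 ≤ D)
    (hD : interaction K A B ≤ ENNReal.ofReal D) :
    c * (volume.real A * volume.real B) ≤ D := by
  have h := (ofReal_mul_volume_mul_volume_le_interaction hA hB hc).trans hD
  rwa [← ofReal_measureReal hAfin, ← ofReal_measureReal hBfin,
    ← ENNReal.ofReal_mul measureReal_nonneg, ← ENNReal.ofReal_mul hc₀,
    ENNReal.ofReal_le_ofReal_iff hD₀] at h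

theorem interaction_mono {A A' B B' : Set (Rn n)} (hA : A ⊆ A') (hB : B ⊆ B') :
    interaction K A B ≤ interaction K A' B' :=
  (lintegral_mono fun _ => lintegral_mono_set hB).trans (lintegral_mono_set hA)

theorem mem_shear_image_iff {V : Type*} [NormedAddCommGroup V] [NormedSpace ℝ V] {η : V → ℝ}
    {e : V} {t : ℝ} (hinj : Function.Injective (shear η e (-t))) (E : Set V) {x : V}
    (hx : η (x + t • e) = 1) : x ∈ shear η e (-t) '' E ↔ x + t • e ∈ E := by
  have h : shear η e (-t) (x + t • e) = x := by
    rw [shear, hx]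
    module
  rw [← hinj.mem_set_image (s := E) (a := x + t • e), h]

theorem interaction_translate_le_interaction_shear {η : Rn n → ℝ} {e : Rn n} {t : ℝ}
    (hinj : Function.Injective (shear η e (-t))) {U : Set (Rn n)} (E : Set (Rn n))
    (hη : ∀ x ∈ U, η (x + t • e) = 1) :
    interaction K ((U ∩ (· + t • e) ⁻¹' E) \ (U ∩ E)) ((U ∩ E) \ (U ∩ (· + t • e) ⁻¹' E)) ≤
      interaction K (shear η e (-t) '' E \ E) (E \ shear η e (-t) '' E) := by
  refine interaction_mono ?_ ?_
  · rintro x ⟨⟨hxU, hxE⟩, hx⟩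
    exact ⟨(mem_shear_image_iff hinj E (hη x hxU)).2 hxE, fun h => hx ⟨hxU, h⟩⟩
  · rintro x ⟨⟨hxU, hxE⟩, hx⟩
    exact ⟨hxE, fun h => hx ⟨hxU, (mem_shear_image_iff hinj E (hη x hxU)).1 h⟩⟩

theorem KernelClassL2.mul_volume_diff_mul_volume_diff_le (hK : KernelClassL2 s lam Lam K)
    (hs : 0 < s) (hlam : 0 < lam) {r : ℝ} {A B : Set (Rn n)} (hA : MeasurableSet A)
    (hB : MeasurableSet B) (hAr : A ⊆ Metric.ball 0 r) (hBr : B ⊆ Metric.ball 0 r) {D : ℝ}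
    (hD₀ : 0 ≤ D) (hD : interaction K (A \ B) (B \ A) ≤ ENNReal.ofReal D) {R : ℝ} (hR : 0 < R)
    (hrR : r ≤ R) :
    lam / (2 * R) ^ ((n : ℝ) + s) * (volume.real (A \ B) * volume.real (B \ A)) ≤ D := by
  refine mul_volume_mul_volume_le (hA.diff hB) (hB.diff hA)
    (measure_ne_top_of_subset (sdiff_subset.trans hAr) measure_ball_lt_top.ne)
    (measure_ne_top_of_subset (sdiff_subset.trans hBr) measure_ball_lt_top.ne) (by positivity)
    (fun x hx y hy => ?_) hD₀ hD
  refine hK.le_of_norm_le hs hlam (sub_ne_zero.2 fun h : x = y => hy.2 (h ▸ hx.1)) ?_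
  have hxr := mem_ball_zero_iff.1 (hAr hx.1)
  have hyr := mem_ball_zero_iff.1 (hBr hy.1)
  linarith [norm_sub_le x y]

theorem IsShearStable.eventually_interaction_le_ofReal (hK : KernelClassL2 s lam Lam K)
    (hs : 0 < s) (hlam : 0 < lam) {R R₀ : ℝ} {E : Set (Rn n)}
    (hE : IsShearStable K (Metric.ball 0 R₀) E) (hEm : MeasurableSet E) {η : Rn n → ℝ} {e : Rn n}
    {M : ℝ≥0} (hη : ContDiff ℝ 2 η) (hηR : tsupport η ⊆ Metric.ball 0 R)
    (hM : LipschitzWith M η) (he : ‖e‖ = 1) (hR : R ≤ R₀) {p : ℝ} (hp : 0 ≤ p)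
    (hP : kPerimeter K (Metric.ball 0 R) E ≤ ENNReal.ofReal p) :
    ∀ᶠ t in 𝓝 (0 : ℝ), interaction K (shear η e t '' E \ E) (E \ shear η e t '' E) ≤
      ENNReal.ofReal ((32 * harnackConst n s lam Lam * M ^ 2 * p + 4) * t ^ 2) := by
  have hH := hK.one_le_harnackConst hs hlam (norm_ne_zero_iff.1 (he ▸ one_ne_zero))
  have hηc : HasCompactSupport η := (isCompact_closedBall 0 R).of_isClosed_subset
    (isClosed_tsupport η) (hηR.trans Metric.ball_subset_closedBall)
  filter_upwards [hE.eventually_interaction_le hK hs hlam measurableSet_ball hEm hη hηc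
    (hηR.trans (Metric.ball_subset_ball hR)) measurableSet_ball hηR hM he one_pos] with t ht
  refine ht.trans ((add_le_add_left (mul_le_mul_right hP _) _).trans_eq ?_)
  rw [one_mul, ← ENNReal.ofReal_mul (by positivity), ← ENNReal.ofReal_ofNat,
    ← ENNReal.ofReal_mul zero_le_four, ← ENNReal.ofReal_add (by positivity) (by positivity),
    mul_pow, sq_abs]
  congr 1
  ring

theorem IsShearStable.eventually_volume_jumpSet_sq_le (hK : KernelClassL2 s lam Lam K)
    (hs : 0 < s) (hlam : 0 < lam) {r ρ R R₀ : ℝ} {E : Set (Rn n)}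
    (hE : IsShearStable K (Metric.ball 0 R₀) E) (hEm : MeasurableSet E) {η : Rn n → ℝ} {e : Rn n}
    {M : ℝ≥0} (hη : ContDiff ℝ 2 η) (hηR : tsupport η ⊆ Metric.ball 0 R)
    (hη₁ : ∀ x, ‖x‖ ≤ ρ → η x = 1) (hM : LipschitzWith M η) (he : ‖e‖ = 1) (hr : 0 < r)
    (hrρ : r < ρ) (hρ : ρ ≤ R₀) (hR : R ≤ R₀) {p : ℝ} (hp : 0 ≤ p)
    (hP : kPerimeter K (Metric.ball 0 R) E ≤ ENNReal.ofReal p) :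
    ∀ᶠ t in 𝓝[>] (0 : ℝ), volume.real (jumpSet (Metric.ball 0 r) E (t • e)) ^ 2 ≤
      (shellConst (volume : Measure (Rn n)) R₀ ^ 2 + 4 / (lam / (2 * R₀) ^ ((n : ℝ) + s)) *
        (32 * harnackConst n s lam Lam * M ^ 2 * p + 4)) * t ^ 2 := by
  have hH := hK.one_le_harnackConst hs hlam (norm_ne_zero_iff.1 (he ▸ one_ne_zero))
  have hR₀ : 0 < R₀ := by linarith
  have hneg : Tendsto (fun t : ℝ => -t) (𝓝[>] 0) (𝓝 0) :=
    (continuous_neg.tendsto' _ _ neg_zero).mono_left nhdsWithin_le_nhds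
  filter_upwards [hneg.eventually (hE.eventually_interaction_le_ofReal hK hs hlam hEm hη hηR hM he
      hR hp hP), hneg.eventually (eventually_abs_mul_le_half M),
    Ioo_mem_nhdsGT (sub_pos.2 hrρ)] with t hint htM ht
  rw [neg_sq] at hint
  set S := shellConst (volume : Measure (Rn n)) R₀
  set c := lam / (2 * R₀) ^ ((n : ℝ) + s)
  set D := 32 * harnackConst n s lam Lam * M ^ 2 * p + 4
  have hc : 0 < c := by positivity
  have hte : ‖t • e‖ = t := by rw [norm_smul, he, mul_one, Real.norm_of_nonneg ht.1.le]
  have hη_one : ∀ x ∈ Metric.ball (0 : Rn n) r, η (x + t • e) = 1 := fun x hx =>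
    hη₁ _ ((norm_add_le _ _).trans (by linarith [mem_ball_zero_iff.1 hx, ht.2]))
  set A := Metric.ball 0 r ∩ (· + t • e) ⁻¹' E
  set B := Metric.ball 0 r ∩ E
  have hprod : c * (volume.real (A \ B) * volume.real (B \ A)) ≤ D * t ^ 2 :=
    hK.mul_volume_diff_mul_volume_diff_le hs hlam
      (measurableSet_ball.inter (hEm.preimage (measurable_add_const _)))
      (measurableSet_ball.inter hEm) inter_subset_left inter_subset_left (by positivity)
      ((interaction_translate_le_interaction_shear (shear_bijective hM he htM).injective E
        hη_one).trans hint) hR₀ (by linarith)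
  calc volume.real (jumpSet (Metric.ball 0 r) E (t • e)) ^ 2
      ≤ (S * t) ^ 2 + 4 * (volume.real (A \ B) * volume.real (B \ A)) := by
        simpa only [hte] using measureReal_jumpSet_sq_le volume hEm hr (h := t • e) (R := R₀)
          (by linarith [ht.2])
    _ ≤ (S * t) ^ 2 + 4 * (D * t ^ 2 / c) := by
        gcongr
        rwa [le_div_iff₀' hc]
    _ = (S ^ 2 + 4 / c * D) * t ^ 2 := by ring

theorem volume_jumpSet_le_of_sq_le {r b t : ℝ} {E : Set (Rn n)} {h : Rn n} (ht : 0 ≤ t)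
    (hsq : volume.real (jumpSet (Metric.ball 0 r) E h) ^ 2 ≤ b * t ^ 2) :
    volume (jumpSet (Metric.ball 0 r) E h) ≤ ENNReal.ofReal (√b * t) := by
  have hfin : volume (jumpSet (Metric.ball 0 r) E h) ≠ ∞ :=
    measure_ne_top_of_subset (fun x hx => hx.1) measure_ball_lt_top.ne
  rw [← ofReal_measureReal hfin]
  refine ENNReal.ofReal_le_ofReal ((le_abs_self _).trans ?_)
  simpa only [Real.sqrt_mul' _ (sq_nonneg t), Real.sqrt_sq ht] using Real.abs_le_sqrt hsq

theorem exists_hasJumpBound_of_kPerimeter_le (n : ℕ) {s lam : ℝ} (hs : 0 < s) (hlam : 0 < lam)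
    (Lam : ℝ) {R₀ : ℝ} (hR₀ : 0 < R₀) :
    ∃ C : ℝ, 0 < C ∧ ∀ K : Rn n → ℝ, KernelClassL2 s lam Lam K → ∀ E : Set (Rn n),
      MeasurableSet E → IsShearStable K (Metric.ball 0 R₀) E →
      ∀ r R p : ℝ, 0 < r → r < R → R ≤ R₀ → 0 ≤ p →
      kPerimeter K (Metric.ball 0 R) E ≤ ENNReal.ofReal p →
      HasJumpBound volume (Metric.ball 0 r) E √(C * (1 + p / (R - r) ^ 2)) := by
  obtain ⟨L, hL⟩ := exists_lipschitzWith_smoothTransition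
  set H := harnackConst n s lam Lam
  set S := shellConst (volume : Measure (Rn n)) R₀
  set c := lam / (2 * R₀) ^ ((n : ℝ) + s)
  have : 0 < c := by positivity
  set a := 32 * |H| * (L * 4) ^ 2
  have ha : 0 ≤ a := by positivity
  refine ⟨S ^ 2 + 4 / c * (a + 4), by positivity, ?_⟩
  intro K hK E hEm hE r R p hr hrR hR hp hP
  set q := p / (R - r) ^ 2 with hq
  have hq₀ : 0 ≤ q := by positivity
  obtain ⟨η, M, hη, hηR, hη₁, hM, hMeq⟩ := exists_contDiff_cutoff (V := Rn n) hL hr hrR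
  have hD : 32 * H * M ^ 2 * p + 4 ≤ (a + 4) * (1 + q) := by
    calc 32 * H * M ^ 2 * p + 4 ≤ 32 * |H| * M ^ 2 * p + 4 := by
          gcongr
          exact le_abs_self H
      _ = a * q + 4 := by
          rw [hMeq, hq, div_pow]
          ring
      _ ≤ (a + 4) * (1 + q) := by nlinarith
  refine hasJumpBound_of_eventually (convex_ball 0 r) fun e he => ?_
  filter_upwards [hE.eventually_volume_jumpSet_sq_le hK hs hlam hEm hη hηR hη₁ hM he hr
    (by linarith) (by linarith) hR hp hP, self_mem_nhdsWithin] with t hjump ht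
  refine volume_jumpSet_le_of_sq_le (le_of_lt ht)
    (hjump.trans (mul_le_mul_of_nonneg_right ?_ (sq_nonneg t)))
  calc S ^ 2 + 4 / c * (32 * H * M ^ 2 * p + 4)
      ≤ S ^ 2 * (1 + q) + 4 / c * ((a + 4) * (1 + q)) := by
        gcongr
        exact le_mul_of_one_le_right (sq_nonneg S) (by linarith)
    _ = (S ^ 2 + 4 / c * (a + 4)) * (1 + q) := by ring

end PerimeterToJump

/-! ### From jump bounds to the nonlocal perimeter -/

section SeparatedSet

/-- The points `x ∈ U` that the set `E` separates from `x + h`. In contrast to `jumpSet`, the point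
`x + h` may lie outside `U`. -/
def separatedSet {V : Type*} [Add V] (U E : Set V) (h : V) : Set V :=
  {x | x ∈ U ∧ ¬(x ∈ E ↔ x + h ∈ E)}

theorem separatedSet_zero {V : Type*} [AddZeroClass V] (U E : Set V) : separatedSet U E 0 = ∅ := by
  simp [separatedSet]

theorem separatedSet_ball_subset_jumpSet {V : Type*} [NormedAddCommGroup V] (E : Set V) {r R : ℝ}
    {h : V} (hR : r + ‖h‖ ≤ R) :
    separatedSet (Metric.ball 0 r) E h ⊆ jumpSet (Metric.ball 0 R) E h := by
  rintro x ⟨hx, hne⟩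
  rw [mem_ball_zero_iff] at hx
  refine ⟨mem_ball_zero_iff.2 (by linarith [norm_nonneg h]), mem_ball_zero_iff.2 ?_, hne⟩
  linarith [norm_add_le x h]

theorem setLIntegral_comp_sub_eq_lintegral_mul_measure {G : Type*} [AddGroup G] [MeasurableSpace G]
    [MeasurableAdd₂ G] [MeasurableNeg G] {μ : Measure G} [SFinite μ] [μ.IsAddLeftInvariant]
    {S : Set (G × G)} (hS : MeasurableSet S) {f : G → ℝ≥0∞} (hf : Measurable f) :
    ∫⁻ p in S, f (-p.1 + p.2) ∂μ.prod μ = ∫⁻ h, f h * μ {x | (x, x + h) ∈ S} ∂μ := by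
  set T : G × G → G × G := fun z => (z.1, z.1 + z.2)
  have hT : MeasurePreserving T (μ.prod μ) (μ.prod μ) := measurePreserving_prod_add μ μ
  have hTS : MeasurableSet (T ⁻¹' S) := hT.measurable hS
  have hfT : Measurable fun p : G × G => f (-p.1 + p.2) :=
    hf.comp (measurable_fst.neg.add measurable_snd)
  rw [← hT.setLIntegral_comp_preimage hS hfT]
  simp only [T, neg_add_cancel_left]
  rw [← lintegral_indicator hTS,
    lintegral_prod_symm _ (Measurable.indicator (by fun_prop) hTS).aemeasurable]
  refine lintegral_congr fun h => ?_
  have hslice : MeasurableSet {x | (x, x + h) ∈ S} := measurable_prodMk_right hTS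
  rw [← setLIntegral_const, ← lintegral_indicator hslice]
  rfl

variable {n : ℕ} {K : Rn n → ℝ}

theorem kPerimeter_le_lintegral_separatedSet (hK : Measurable K) (hKe : ∀ z, K (-z) = K z)
    {Ω E : Set (Rn n)} (hΩ : MeasurableSet Ω) (hE : MeasurableSet E) :
    kPerimeter K Ω E ≤ 2 * ∫⁻ h, ENNReal.ofReal (K h) * volume (separatedSet Ω E h) := by
  set k : Rn n × Rn n → ℝ≥0∞ := fun p => ENNReal.ofReal (K (p.1 - p.2))
  have hk : Measurable k := measurable_kernel_sub hK
  have hk_swap (p : Rn n × Rn n) : k p.swap = k p := by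
    simp only [k, Prod.fst_swap, Prod.snd_swap, ← hKe (p.1 - p.2), neg_sub]
  have hk_eq (p : Rn n × Rn n) : k p = ENNReal.ofReal (K (-p.1 + p.2)) := by
    rw [← hk_swap, neg_add_eq_sub]
    rfl
  set S : Set (Rn n × Rn n) := Ω ×ˢ univ ∩ (E ×ˢ Eᶜ ∪ Eᶜ ×ˢ E)
  have hS : MeasurableSet S :=
    (hΩ.prod MeasurableSet.univ).inter ((hE.prod hE.compl).union (hE.compl.prod hE))
  have hcross : crossing Ω E ⊆ S ∪ Prod.swap ⁻¹' S := by
    rintro ⟨x, y⟩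
    simp only [crossing, S, Set.mem_sdiff, mem_union, mem_inter_iff, mem_preimage, mem_prod,
      mem_univ, mem_compl_iff, Prod.swap_prod_mk]
    tauto
  have hslice (h : Rn n) : {x | (x, x + h) ∈ S} = separatedSet Ω E h := by
    ext x
    simp only [S, separatedSet, mem_ofPred_eq, mem_union, mem_inter_iff, mem_prod, mem_univ,
      mem_compl_iff]
    tauto
  have hswap : ∫⁻ p in Prod.swap ⁻¹' S, k p = ∫⁻ p in S, k p := by
    rw [Measure.volume_eq_prod, ← Measure.measurePreserving_swap.setLIntegral_comp_preimage hS hk]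
    simp only [hk_swap]
  calc kPerimeter K Ω E ≤ ∫⁻ p in S ∪ Prod.swap ⁻¹' S, k p :=
        (kPerimeter_eq_setLIntegral hK hΩ hE).trans_le (lintegral_mono_set hcross)
    _ ≤ 2 * ∫⁻ p in S, k p := by
        rw [two_mul]
        exact (lintegral_union_le _ _ _).trans_eq (by rw [hswap])
    _ = 2 * ∫⁻ h, ENNReal.ofReal (K h) * volume (separatedSet Ω E h) := by
        simp only [hk_eq, ← hslice]
        rw [Measure.volume_eq_prod,
          setLIntegral_comp_sub_eq_lintegral_mul_measure hS hK.ennreal_ofReal]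

end SeparatedSet

section JumpToPerimeter

theorem lintegral_ball_norm_rpow_neg_lt_top {V : Type*} [NormedAddCommGroup V] [NormedSpace ℝ V]
    [FiniteDimensional ℝ V] [MeasurableSpace V] [BorelSpace V] (μ : Measure V) [μ.IsAddHaarMeasure]
    {p : ℝ} (hp : p < Module.finrank ℝ V) (r : ℝ) :
    ∫⁻ x in Metric.ball (0 : V) r, ENNReal.ofReal (‖x‖ ^ (-p)) ∂μ < ∞ := by
  rcases subsingleton_or_nontrivial V with hV | hV
  · simp only [Subsingleton.elim _ (0 : V), norm_zero, setLIntegral_const]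
    exact ENNReal.mul_lt_top ENNReal.ofReal_lt_top measure_ball_lt_top
  · refine IntegrableOn.setLIntegral_lt_top
      (integrableOn_ball_of_norm_le_rpow Module.finrank_pos (C := 1) hp ?_
        (measurable_norm.pow_const _).aestronglyMeasurable)
    refine Eventually.of_forall fun x => ?_
    rw [one_mul, Real.norm_of_nonneg (by positivity)]

theorem rpow_neg_le_mul_one_add_rpow_neg {d τ q : ℝ} {m : ℕ} (hd : 0 < d) (hd₁ : d ≤ 1)
    (hτ : d ≤ τ) (hq : 0 ≤ q) (hqm : q ≤ m) :
    τ ^ (-q) ≤ 2 ^ m * (d ^ m)⁻¹ * (1 + τ) ^ (-q) := by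
  have hτ₀ : 0 < τ := hd.trans_le hτ
  have hle : d / 2 * (1 + τ) ≤ τ := by nlinarith
  calc τ ^ (-q) ≤ (d / 2 * (1 + τ)) ^ (-q) :=
        Real.rpow_le_rpow_of_nonpos (by positivity) hle (neg_nonpos.2 hq)
    _ = (d / 2) ^ (-q) * (1 + τ) ^ (-q) := Real.mul_rpow (by positivity) (by positivity)
    _ ≤ (d / 2) ^ (-(m : ℝ)) * (1 + τ) ^ (-q) := by
        gcongr ?_ * _
        exact Real.rpow_le_rpow_of_exponent_ge (by positivity) (by linarith) (neg_le_neg hqm)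
    _ = 2 ^ m * (d ^ m)⁻¹ * (1 + τ) ^ (-q) := by
        rw [Real.rpow_neg (by positivity), Real.rpow_natCast, div_pow, inv_div, div_eq_mul_inv]

variable {n : ℕ} {s lam Lam : ℝ} {K : Rn n → ℝ}

theorem KernelClassL2.le_mul_norm_rpow (hK : KernelClassL2 s lam Lam K) {z : Rn n} (hz : z ≠ 0) :
    K z ≤ |Lam| * ‖z‖ ^ (-((n : ℝ) + s)) := by
  rw [Real.rpow_neg (norm_nonneg z), ← div_eq_mul_inv]
  refine (hK.upper z hz).trans ?_
  gcongr
  exact le_abs_self Lam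

theorem KernelClassL2.mul_volume_separatedSet_le_of_norm_lt (hK : KernelClassL2 s lam Lam K)
    {E : Set (Rn n)} {r R w : ℝ} (hE : HasJumpBound volume (Metric.ball 0 R) E w) {h : Rn n}
    (hh : h ≠ 0) (hR : r + ‖h‖ ≤ R) :
    ENNReal.ofReal (K h) * volume (separatedSet (Metric.ball 0 r) E h) ≤
      ENNReal.ofReal (|Lam| * w) * ENNReal.ofReal (‖h‖ ^ (-((n : ℝ) + s - 1))) := by
  have hh₀ : 0 < ‖h‖ := norm_pos_iff.2 hh
  calc ENNReal.ofReal (K h) * volume (separatedSet (Metric.ball 0 r) E h)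
      ≤ ENNReal.ofReal (|Lam| * ‖h‖ ^ (-((n : ℝ) + s))) * ENNReal.ofReal (w * ‖h‖) :=
        mul_le_mul' (ENNReal.ofReal_le_ofReal (hK.le_mul_norm_rpow hh))
          ((measure_mono (separatedSet_ball_subset_jumpSet E hR)).trans (hE h))
    _ = ENNReal.ofReal (|Lam| * w) * ENNReal.ofReal (‖h‖ ^ (-((n : ℝ) + s - 1))) := by
        rw [← ENNReal.ofReal_mul (by positivity), ← ENNReal.ofReal_mul' (by positivity),
          show -((n : ℝ) + s - 1) = -((n : ℝ) + s) + 1 by ring, Real.rpow_add_one hh₀.ne']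
        congr 1
        ring

theorem KernelClassL2.mul_volume_separatedSet_le_of_le_norm (hK : KernelClassL2 s lam Lam K)
    (hs : 0 < s) (hs₁ : s ≤ 1) {U : Set (Rn n)} (E : Set (Rn n)) {d : ℝ} (hd : 0 < d) (hd₁ : d ≤ 1)
    {h : Rn n} (hh : d ≤ ‖h‖) :
    ENNReal.ofReal (K h) * volume (separatedSet U E h) ≤
      ENNReal.ofReal (|Lam| * (2 ^ (n + 1) * (d ^ (n + 1))⁻¹)) * volume U *
        ENNReal.ofReal ((1 + ‖h‖) ^ (-((n : ℝ) + s))) := by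
  have hpow : ‖h‖ ^ (-((n : ℝ) + s)) ≤
      2 ^ (n + 1) * (d ^ (n + 1))⁻¹ * (1 + ‖h‖) ^ (-((n : ℝ) + s)) :=
    rpow_neg_le_mul_one_add_rpow_neg hd hd₁ hh (by positivity) (by push_cast; linarith)
  have hKh : K h ≤
      |Lam| * (2 ^ (n + 1) * (d ^ (n + 1))⁻¹) * (1 + ‖h‖) ^ (-((n : ℝ) + s)) := by
    refine (hK.le_mul_norm_rpow (norm_pos_iff.1 (hd.trans_le hh))).trans ?_
    rw [mul_assoc]
    gcongr
  refine (mul_le_mul' (ENNReal.ofReal_le_ofReal hKh) (measure_mono fun _ hx => hx.1)).trans_eq ?_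
  rw [ENNReal.ofReal_mul (by positivity)]
  ring

theorem HasJumpBound.kPerimeter_le (hK : KernelClassL2 s lam Lam K) (hs : 0 < s) (hs₁ : s ≤ 1)
    (hlam : 0 < lam) {E : Set (Rn n)} (hEm : MeasurableSet E) {r R w : ℝ} (hrR : r < R)
    (hR : R ≤ r + 1) (hE : HasJumpBound volume (Metric.ball 0 R) E w) :
    kPerimeter K (Metric.ball 0 r) E ≤
      2 * (ENNReal.ofReal (|Lam| * w) *
          (∫⁻ h in Metric.ball (0 : Rn n) 1, ENNReal.ofReal (‖h‖ ^ (-((n : ℝ) + s - 1)))) +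
        ENNReal.ofReal (|Lam| * (2 ^ (n + 1) * ((R - r) ^ (n + 1))⁻¹)) *
          volume (Metric.ball (0 : Rn n) r) *
          ∫⁻ h : Rn n, ENNReal.ofReal ((1 + ‖h‖) ^ (-((n : ℝ) + s)))) := by
  set f : Rn n → ℝ≥0∞ :=
    (Metric.ball 0 1).indicator fun h => ENNReal.ofReal (‖h‖ ^ (-((n : ℝ) + s - 1)))
  have hf : Measurable f :=
    (measurable_norm.pow_const _).ennreal_ofReal.indicator measurableSet_ball
  have hg : Measurable fun h : Rn n => ENNReal.ofReal ((1 + ‖h‖) ^ (-((n : ℝ) + s))) :=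
    ((measurable_norm.const_add 1).pow_const _).ennreal_ofReal
  have hpointwise (h : Rn n) :
      ENNReal.ofReal (K h) * volume (separatedSet (Metric.ball 0 r) E h) ≤
        ENNReal.ofReal (|Lam| * w) * f h +
          ENNReal.ofReal (|Lam| * (2 ^ (n + 1) * ((R - r) ^ (n + 1))⁻¹)) *
            volume (Metric.ball (0 : Rn n) r) *
            ENNReal.ofReal ((1 + ‖h‖) ^ (-((n : ℝ) + s))) := by
    rcases eq_or_ne h 0 with rfl | hh
    · simp [separatedSet_zero]
    rcases lt_or_ge ‖h‖ (R - r) with hnear | hfar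
    · refine le_add_right ?_
      have hh₁ : h ∈ Metric.ball (0 : Rn n) 1 := mem_ball_zero_iff.2 (by linarith)
      simp only [f, indicator_of_mem hh₁]
      exact hK.mul_volume_separatedSet_le_of_norm_lt hE hh (by linarith)
    · exact le_add_left (hK.mul_volume_separatedSet_le_of_le_norm hs hs₁ E (sub_pos.2 hrR)
        (by linarith) hfar)
  calc kPerimeter K (Metric.ball 0 r) E
      ≤ 2 * ∫⁻ h, ENNReal.ofReal (K h) * volume (separatedSet (Metric.ball 0 r) E h) :=
        kPerimeter_le_lintegral_separatedSet (hK.measurable hs hlam) hK.even measurableSet_ball hEm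
    _ ≤ _ := mul_le_mul_right (lintegral_mono hpointwise) 2
    _ = _ := by
        rw [lintegral_add_left (hf.const_mul _), lintegral_const_mul _ hf,
          lintegral_const_mul _ hg, lintegral_indicator measurableSet_ball]

theorem exists_kPerimeter_le_of_hasJumpBound (n : ℕ) {s lam : ℝ} (hs : 0 < s) (hs₁ : s < 1)
    (hlam : 0 < lam) (Lam R₀ : ℝ) :
    ∃ C : ℝ, 0 < C ∧ ∀ K : Rn n → ℝ, KernelClassL2 s lam Lam K → ∀ E : Set (Rn n),
      MeasurableSet E → ∀ r R w : ℝ, r < R → R ≤ R₀ → R ≤ r + 1 → 0 ≤ w →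
      HasJumpBound volume (Metric.ball 0 R) E w →
      kPerimeter K (Metric.ball 0 r) E ≤ ENNReal.ofReal (C * (w + ((R - r) ^ (n + 1))⁻¹)) := by
  set I := ∫⁻ h in Metric.ball (0 : Rn n) 1, ENNReal.ofReal (‖h‖ ^ (-((n : ℝ) + s - 1)))
  set J := ∫⁻ h : Rn n, ENNReal.ofReal ((1 + ‖h‖) ^ (-((n : ℝ) + s)))
  have hI : I < ∞ := lintegral_ball_norm_rpow_neg_lt_top volume
    (by rw [finrank_euclideanSpace_fin]; linarith) 1
  have hJ : J < ∞ := finite_integral_one_add_norm (by rw [finrank_euclideanSpace_fin]; linarith)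
  obtain ⟨i, hi, hIi⟩ : ∃ i, 0 ≤ i ∧ I = ENNReal.ofReal i :=
    ⟨I.toReal, ENNReal.toReal_nonneg, (ENNReal.ofReal_toReal hI.ne).symm⟩
  obtain ⟨j, hj, hJj⟩ : ∃ j, 0 ≤ j ∧ J = ENNReal.ofReal j :=
    ⟨J.toReal, ENNReal.toReal_nonneg, (ENNReal.ofReal_toReal hJ.ne).symm⟩
  set β := volume.real (Metric.ball (0 : Rn n) R₀)
  set a := 2 * |Lam| * i
  set b := 2 * |Lam| * 2 ^ (n + 1) * β * j
  have ha : 0 ≤ a := by positivity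
  have hb : 0 ≤ b := by positivity
  refine ⟨a + b + 1, by positivity, ?_⟩
  intro K hK E hEm r R w hrR hRR₀ hR hw hE
  set δ := ((R - r) ^ (n + 1))⁻¹
  have hδ : 0 ≤ δ := inv_nonneg.2 (pow_nonneg (sub_nonneg.2 hrR.le) _)
  have hball : volume (Metric.ball (0 : Rn n) r) ≤ ENNReal.ofReal β := by
    rw [ofReal_measureReal measure_ball_lt_top.ne]
    exact measure_mono (Metric.ball_subset_ball (hrR.le.trans hRR₀))
  calc kPerimeter K (Metric.ball 0 r) E
      ≤ 2 * (ENNReal.ofReal (|Lam| * w) * I +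
          ENNReal.ofReal (|Lam| * (2 ^ (n + 1) * δ)) * volume (Metric.ball (0 : Rn n) r) * J) :=
        hE.kPerimeter_le hK hs hs₁.le hlam hEm hrR hR
    _ ≤ 2 * (ENNReal.ofReal (|Lam| * w) * I +
          ENNReal.ofReal (|Lam| * (2 ^ (n + 1) * δ)) * ENNReal.ofReal β * J) := by gcongr
    _ = ENNReal.ofReal (a * w + b * δ) := by
        rw [hIi, hJj, ← ENNReal.ofReal_ofNat, ← ENNReal.ofReal_mul (by positivity),
          ← ENNReal.ofReal_mul (by positivity), ← ENNReal.ofReal_mul (by positivity),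
          ← ENNReal.ofReal_add (by positivity) (by positivity), ← ENNReal.ofReal_mul zero_le_two]
        congr 1
        ring
    _ ≤ ENNReal.ofReal ((a + b + 1) * (w + δ)) :=
        ENNReal.ofReal_le_ofReal (by nlinarith [mul_nonneg ha hδ, mul_nonneg hb hw])

end JumpToPerimeter

/-! ### Absorption -/

section Absorption

theorem exists_lt_of_half_add_mem {T : Set ℝ} (hT : T.Nonempty) (hbdd : BddBelow T) {A c : ℝ}
    (hhalf : ∀ S ∈ T, S / 2 + A ∈ T) (hc : 2 * A < c) : ∃ S ∈ T, S < c := by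
  have hinf : 2 * (sInf T - A) ≤ sInf T :=
    le_csInf hT fun S hS => by linarith [csInf_le hbdd (hhalf S hS)]
  exact exists_lt_of_csInf_lt hT (by linarith)

theorem sqrt_mul_one_add_div_pow_le {C S d : ℝ} (m : ℕ) (hC : 0 ≤ C) (hS : 0 ≤ S) (hd : 0 < d)
    (hd₁ : d ≤ 1) :
    √(C * (1 + S / d ^ m) / d ^ m) ≤ (S / 2 + (C * 4 ^ m + 1)) / (2 * d) ^ m := by
  refine Real.sqrt_le_iff.2 ⟨by positivity, ?_⟩
  have hnum : C * 4 ^ m * (1 + S) ≤ (S / 2 + (C * 4 ^ m + 1)) ^ 2 := by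
    have hB : 0 ≤ C * 4 ^ m := by positivity
    nlinarith [mul_nonneg hB hS, sq_nonneg S]
  have hone : 1 + S / d ^ m ≤ (1 + S) / d ^ m := by
    rw [add_div]
    gcongr
    exact one_le_one_div (by positivity) (pow_le_one₀ hd.le hd₁)
  calc C * (1 + S / d ^ m) / d ^ m ≤ C * ((1 + S) / d ^ m) / d ^ m := by gcongr
    _ = C * 4 ^ m * (1 + S) / ((2 * d) ^ m) ^ 2 := by
        rw [← pow_mul, mul_comm m 2, pow_mul, mul_pow, mul_pow, show (2 : ℝ) ^ 2 = 4 by norm_num,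
          ← pow_mul, mul_comm 2 m, pow_mul]
        field_simp
    _ ≤ (S / 2 + (C * 4 ^ m + 1)) ^ 2 / ((2 * d) ^ m) ^ 2 := by gcongr
    _ = ((S / 2 + (C * 4 ^ m + 1)) / (2 * d) ^ m) ^ 2 := (div_pow _ _ 2).symm

-- The sublinear growth `√w` beats the blow-up of the constant on thin shells, so the bound no
-- longer depends on the initial one.
theorem bound_of_forall_sqrt_bound {P : ℝ → ℝ → Prop} {a b C : ℝ} {m : ℕ} (hab : a < b)
    (hba : b ≤ a + 1) (hC : 0 ≤ C) (hmono : ∀ r v v', v ≤ v' → P r v → P r v')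
    (hinit : ∃ w, ∀ r ∈ Ico a b, P r w)
    (hstep : ∀ r R w, a ≤ r → r < R → R < b → 0 ≤ w → P R w →
      P r √(C * (1 + w) / (R - r) ^ m)) :
    P a ((2 * (C * 4 ^ m + 1) + 1) / (b - a) ^ m) := by
  let T : Set ℝ := {S | 0 ≤ S ∧ ∀ r ∈ Ico a b, P r (S / (b - r) ^ m)}
  have hT : T.Nonempty := by
    obtain ⟨w, hw⟩ := hinit
    refine ⟨|w|, abs_nonneg w, fun r hr => hmono r w _ ?_ (hw r hr)⟩
    exact (le_abs_self w).trans (le_div_self (abs_nonneg w) (pow_pos (sub_pos.2 hr.2) m)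
      (pow_le_one₀ (sub_pos.2 hr.2).le (by linarith [hr.1])))
  have hhalf : ∀ S ∈ T, S / 2 + (C * 4 ^ m + 1) ∈ T := by
    rintro S ⟨hS, hP⟩
    refine ⟨by positivity, fun r hr => ?_⟩
    obtain ⟨d, hd⟩ : ∃ d, b = r + 2 * d := ⟨(b - r) / 2, by ring⟩
    have hd₀ : 0 < d := by linarith [hr.2]
    have hmid : P (r + d) (S / d ^ m) := by
      simpa only [hd, show r + 2 * d - (r + d) = d by ring] using
        hP (r + d) ⟨by linarith [hr.1], by linarith⟩
    have hP' := hstep r (r + d) _ hr.1 (by linarith) (by linarith) (by positivity) hmid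
    rw [add_sub_cancel_left] at hP'
    rw [hd, add_sub_cancel_left]
    exact hmono r _ _ (sqrt_mul_one_add_div_pow_le m hC hS hd₀ (by linarith [hr.1])) hP'
  obtain ⟨S, hS, hlt⟩ := exists_lt_of_half_add_mem hT ⟨0, fun S hS => hS.1⟩ hhalf
    (lt_add_one (2 * (C * 4 ^ m + 1)))
  refine hmono a _ _ ?_ (hS.2 a ⟨le_rfl, hab⟩)
  have : 0 < b - a := sub_pos.2 hab
  gcongr

variable (n : ℕ) {s lam : ℝ} (hs : 0 < s) (hs₁ : s < 1) (hlam : 0 < lam) (Lam : ℝ) {R₀ : ℝ}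
include hs hs₁ hlam

theorem exists_hasJumpBound_sqrt_of_hasJumpBound (hR₀ : 0 < R₀) :
    ∃ C : ℝ, 0 < C ∧ ∀ K : Rn n → ℝ, KernelClassL2 s lam Lam K → ∀ E : Set (Rn n),
      MeasurableSet E → IsShearStable K (Metric.ball 0 R₀) E →
      ∀ r R w : ℝ, 0 < r → r < R → R ≤ R₀ → R ≤ r + 1 → 0 ≤ w →
      HasJumpBound volume (Metric.ball 0 R) E w →
      HasJumpBound volume (Metric.ball 0 r) E √(C * (1 + w) / (R - r) ^ (n + 3)) := by
  obtain ⟨A, hA, hjump⟩ := exists_hasJumpBound_of_kPerimeter_le n hs hlam Lam hR₀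
  obtain ⟨B, hB, hper⟩ := exists_kPerimeter_le_of_hasJumpBound n hs hs₁ hlam Lam R₀
  refine ⟨A * (1 + B * 2 ^ (n + 3)), by positivity, ?_⟩
  intro K hK E hEm hE r R w hr hrR hRR₀ hR hw hEw
  obtain ⟨d, rfl⟩ : ∃ d, R = r + 2 * d := ⟨(R - r) / 2, by ring⟩
  have hd : 0 < d := by linarith
  have hP := hper K hK E hEm (r + d) (r + 2 * d) w (by linarith) hRR₀ (by linarith) hw hEw
  rw [show r + 2 * d - (r + d) = d by ring] at hP
  have hbound := hjump K hK E hEm hE r (r + d) _ hr (by linarith) (by linarith) (by positivity) hP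
  refine hbound.mono (Real.sqrt_le_sqrt ?_)
  rw [add_sub_cancel_left, add_sub_cancel_left]
  have hdiv : B * (w + (d ^ (n + 1))⁻¹) / d ^ 2 ≤ B * ((1 + w) / d ^ (n + 3)) := by
    have hw' : w / d ^ 2 ≤ w / d ^ (n + 3) := by
      gcongr w / ?_
      exact pow_le_pow_of_le_one hd.le (by linarith) (by omega)
    calc B * (w + (d ^ (n + 1))⁻¹) / d ^ 2 = B * (w / d ^ 2 + 1 / d ^ (n + 3)) := by
          rw [show n + 3 = n + 1 + 2 by ring, pow_add d (n + 1) 2]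
          field_simp
      _ ≤ B * (w / d ^ (n + 3) + 1 / d ^ (n + 3)) := by gcongr
      _ = B * ((1 + w) / d ^ (n + 3)) := by ring
  have hone : 1 ≤ (1 + w) / (2 * d) ^ (n + 3) :=
    (one_le_div (by positivity)).2
      ((pow_le_one₀ (by positivity) (by linarith)).trans (le_add_of_nonneg_right hw))
  calc A * (1 + B * (w + (d ^ (n + 1))⁻¹) / d ^ 2)
      ≤ A * ((1 + w) / (2 * d) ^ (n + 3) + B * ((1 + w) / d ^ (n + 3))) := by gcongr
    _ = A * (1 + B * 2 ^ (n + 3)) * (1 + w) / (2 * d) ^ (n + 3) := by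
        rw [mul_pow]
        field_simp

theorem exists_hasJumpBound_of_isShearStable {r : ℝ} (hr : 0 < r) (hrR₀ : r < R₀) :
    ∃ C : ℝ, 0 ≤ C ∧ ∀ K : Rn n → ℝ, KernelClassL2 s lam Lam K → ∀ E : Set (Rn n),
      MeasurableSet E → IsShearStable K (Metric.ball 0 R₀) E →
      HasJumpBound volume (Metric.ball 0 r) E C := by
  have hR₀ := hr.trans hrR₀
  obtain ⟨A, -, hjump⟩ := exists_hasJumpBound_of_kPerimeter_le n hs hlam Lam hR₀
  obtain ⟨C, hC, himprove⟩ := exists_hasJumpBound_sqrt_of_hasJumpBound n hs hs₁ hlam Lam hR₀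
  obtain ⟨R, hrR, hR⟩ := exists_between (lt_min hrR₀ (lt_add_one r))
  obtain ⟨hRR₀, hRr⟩ := lt_min_iff.1 hR
  have : 0 < R - r := sub_pos.2 hrR
  refine ⟨(2 * (C * 4 ^ (n + 3) + 1) + 1) / (R - r) ^ (n + 3), by positivity, ?_⟩
  intro K hK E hEm hE
  have hinit := hjump K hK E hEm hE R R₀ _ (hr.trans hrR) hRR₀ le_rfl ENNReal.toReal_nonneg
    (ENNReal.ofReal_toReal hE.1.ne).ge
  refine bound_of_forall_sqrt_bound (P := fun ρ => HasJumpBound volume (Metric.ball 0 ρ) E)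
    hrR hRr.le hC.le (fun _ _ _ hle h => h.mono hle)
    ⟨_, fun ρ hρ => hinit.anti_set (Metric.ball_subset_ball hρ.2.le)⟩ ?_
  intro ρ ρ' w hρ hρρ' hρ' hw
  exact himprove K hK E hEm hE ρ ρ' w (hr.trans_le hρ) hρρ' (hρ'.trans hRR₀).le (by linarith) hw

end Absorption

/-! ### From jump sets to the total variation -/

section DirectionalVariation

variable {V : Type*} [NormedAddCommGroup V]

theorem norm_mul_indicator_sub_le {U E : Set V} {f : V → ℝ} (hf : ∀ x, ‖f x‖ ≤ 1) {k x : V}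
    (hU : f x ≠ 0 → x ∈ U ∧ x + k ∈ U) :
    ‖f x * ((E ∩ U).indicator 1 (x + k) - (E ∩ U).indicator 1 x)‖ ≤
      (jumpSet U E k).indicator 1 x := by
  rcases eq_or_ne (f x) 0 with hfx | hfx
  · rw [hfx, zero_mul, norm_zero]
    exact indicator_nonneg (fun _ _ => zero_le_one) x
  · obtain ⟨hx, hxk⟩ := hU hfx
    have hfx₁ : |f x| ≤ 1 := hf x
    by_cases hE : x ∈ E <;> by_cases hEk : x + k ∈ E <;>
      simp [jumpSet, hx, hxk, hE, hEk, hfx₁]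

theorem eventually_add_smul_mem_of_tsupport_subset [NormedSpace ℝ V] {U : Set V} (hU : IsOpen U)
    {f : V → ℝ} (hfc : HasCompactSupport f) (hfU : tsupport f ⊆ U) (e : V) :
    ∀ᶠ t in 𝓝 (0 : ℝ), ∀ x ∈ tsupport f, x + t • e ∈ U := by
  have hcont : Continuous fun p : ℝ × V => p.2 + p.1 • e := by fun_prop
  refine hfc.isCompact.eventually_forall_of_forall_eventually fun x hx => ?_
  exact hcont.continuousAt.eventually (hU.mem_nhds (by simpa using hfU hx))

variable [MeasurableSpace V] [BorelSpace V]

theorem measurableSet_jumpSet [ContinuousAdd V] {U E : Set V} (hU : MeasurableSet U)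
    (hE : MeasurableSet E) (h : V) : MeasurableSet (jumpSet U E h) := by
  have hadd : Measurable (· + h) := (continuous_add_const h).measurable
  have : jumpSet U E h = U ∩ (· + h) ⁻¹' U ∩ symmDiff E ((· + h) ⁻¹' E) := by
    ext x
    simp only [jumpSet, mem_ofPred_eq, mem_inter_iff, mem_symmDiff, mem_preimage]
    tauto
  rw [this]
  exact (hU.inter (hadd hU)).inter (hE.symmDiff (hadd hE))

variable {μ : Measure V}

theorem integral_add_sub_mul_eq [μ.IsAddRightInvariant] {f g : V → ℝ} {w : V}
    (hfg : Integrable (fun x => f x * g x) μ) (hfwg : Integrable (fun x => f (x + w) * g x) μ) :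
    ∫ x, (f (x + w) - f x) * g x ∂μ = ∫ x, f x * (g (x + -w) - g x) ∂μ := by
  have hshift : (fun x => f (x + w) * g x) = fun x => (fun y => f y * g (y + -w)) (x + w) := by
    simp
  have hfgw : Integrable (fun x => f x * g (x + -w)) μ := by
    simpa using hfwg.comp_add_right (-w)
  simp only [sub_mul, mul_sub]
  rw [integral_sub hfwg hfg, integral_sub hfgw hfg, hshift,
    integral_add_right_eq_self (fun y => f y * g (y + -w)) w]

theorem integral_mul_indicator_sub_le {U E : Set V} (hU : MeasurableSet U) (hμU : μ U ≠ ∞)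
    (hE : MeasurableSet E) {f : V → ℝ} (hf : ∀ x, ‖f x‖ ≤ 1) {k : V}
    (hfU : ∀ x, f x ≠ 0 → x ∈ U ∧ x + k ∈ U) :
    ∫ x, f x * ((E ∩ U).indicator 1 (x + k) - (E ∩ U).indicator 1 x) ∂μ ≤
      μ.real (jumpSet U E k) := by
  have hJ := measurableSet_jumpSet hU hE k
  have hJμ : μ (jumpSet U E k) ≠ ∞ := measure_ne_top_of_subset (fun x hx => hx.1) hμU
  have hint : Integrable ((jumpSet U E k).indicator (1 : V → ℝ)) μ :=
    (integrable_indicator_iff hJ).2 (integrableOn_const hJμ)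
  have hle := norm_integral_le_of_norm_le hint
    (Eventually.of_forall fun x => norm_mul_indicator_sub_le hf (hfU x))
  rw [integral_indicator_one hJ] at hle
  exact (le_abs_self _).trans hle

variable [NormedSpace ℝ V] [FiniteDimensional ℝ V] [μ.IsAddHaarMeasure]

theorem HasJumpBound.integral_lineDeriv_mul_le {U E : Set V} {v : ℝ} (hv : HasJumpBound μ U E v)
    (hv₀ : 0 ≤ v) (hU : IsOpen U) (hμU : μ U ≠ ∞) (hE : MeasurableSet E) {f : V → ℝ} {C : ℝ≥0}
    (hf : LipschitzWith C f) (hf₁ : ∀ x, ‖f x‖ ≤ 1) (hfc : HasCompactSupport f)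
    (hfU : tsupport f ⊆ U) (e : V) :
    ∫ x, lineDeriv ℝ f x e * (E ∩ U).indicator 1 x ∂μ ≤ v * ‖e‖ := by
  set g : V → ℝ := (E ∩ U).indicator 1
  have hg : Integrable g μ := (integrable_indicator_iff (hE.inter hU.measurableSet)).2
    (integrableOn_const (measure_ne_top_of_subset inter_subset_right hμU))
  refine le_of_tendsto (hf.integral_inv_smul_sub_mul_tendsto_integral_lineDeriv_mul hg e) ?_
  have hneg : Tendsto (fun t : ℝ => -t) (𝓝[>] 0) (𝓝 0) := by
    simpa using (continuous_neg.tendsto (0 : ℝ)).mono_left nhdsWithin_le_nhds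
  filter_upwards [self_mem_nhdsWithin,
    hneg.eventually (eventually_add_smul_mem_of_tsupport_subset hU hfc hfU e)] with t ht hmem
  have ht : 0 < t := ht
  have hfg : ∀ w, Integrable (fun x => f (x + w) * g x) μ := fun w =>
    hg.bdd_mul (c := 1) (hf.continuous.comp (continuous_add_const w)).aestronglyMeasurable
      (Eventually.of_forall fun x => hf₁ _)
  have hmem' : ∀ x, f x ≠ 0 → x ∈ U ∧ x + -(t • e) ∈ U := fun x hx =>
    have hxf := subset_tsupport f hx
    ⟨hfU hxf, neg_smul t e ▸ hmem x hxf⟩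
  have hjump : μ.real (jumpSet U E (-(t • e))) ≤ t * (v * ‖e‖) := by
    refine ENNReal.toReal_le_of_le_ofReal (by positivity) ((hv _).trans_eq ?_)
    rw [norm_neg, norm_smul, Real.norm_of_nonneg ht.le, mul_left_comm]
  simp only [smul_eq_mul, mul_assoc]
  rw [integral_const_mul, inv_mul_le_iff₀ ht,
    integral_add_sub_mul_eq (by simpa using hfg 0) (hfg (t • e))]
  exact (integral_mul_indicator_sub_le hU.measurableSet hμU hE hf₁ hmem').trans hjump

end DirectionalVariation

section TotalVariation

variable {n : ℕ}

theorem divergence_eq_sum_lineDeriv {φ : Rn n → Rn n} {x : Rn n}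
    (hφ : DifferentiableAt ℝ φ x) :
    divergence φ x = ∑ i, lineDeriv ℝ (fun y => φ y i) x (EuclideanSpace.single i 1) := by
  refine Finset.sum_congr rfl fun i _ => ?_
  have hi := (EuclideanSpace.proj i : Rn n →L[ℝ] ℝ).hasFDerivAt.comp x hφ.hasFDerivAt
  exact (hi.hasLineDerivAt _).lineDeriv.symm

theorem HasJumpBound.totalVariation_le {U E : Set (Rn n)} {v : ℝ}
    (hv : HasJumpBound volume U E v) (hv₀ : 0 ≤ v) (hU : IsOpen U) (hμU : volume U ≠ ∞)
    (hE : MeasurableSet E) : totalVariation (charFun E) U ≤ ENNReal.ofReal (n * v) := by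
  refine iSup₂_le fun φ hφ => ENNReal.ofReal_le_ofReal ?_
  set g : Rn n → ℝ := (E ∩ U).indicator 1
  have hg : Integrable g := (integrable_indicator_iff (hE.inter hU.measurableSet)).2
    (integrableOn_const (measure_ne_top_of_subset inter_subset_right hμU))
  have hsupp : ∀ i, tsupport (fun x => φ x i) ⊆ tsupport φ := fun i =>
    closure_mono fun x hx h => hx (by simp [h])
  have hcompact : ∀ i, HasCompactSupport fun x => φ x i := fun i =>
    hφ.compactSupport.of_isClosed_subset (isClosed_tsupport _) (hsupp i)
  have hlip : ∀ i, ∃ C, LipschitzWith C fun x => φ x i := fun i =>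
    ((EuclideanSpace.proj i : Rn n →L[ℝ] ℝ).contDiff.comp
      hφ.contDiff).lipschitzWith_of_hasCompactSupport (hcompact i) one_ne_zero
  choose C hC using hlip
  have hint : ∀ i, Integrable fun x =>
      lineDeriv ℝ (fun y => φ y i) x (EuclideanSpace.single i 1) * g x := fun i =>
    hg.bdd_mul (measurable_lineDeriv (hC i).continuous).aestronglyMeasurable
      (Eventually.of_forall fun x => norm_lineDeriv_le_of_lipschitz ℝ (hC i))
  calc ∫ x in U, charFun E x * divergence φ x
      = ∫ x, ∑ i, lineDeriv ℝ (fun y => φ y i) x (EuclideanSpace.single i 1) * g x := by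
        rw [← integral_indicator hU.measurableSet]
        refine integral_congr_ae (Eventually.of_forall fun x => ?_)
        simp only [← Finset.sum_mul,
          ← divergence_eq_sum_lineDeriv (hφ.contDiff.differentiable one_ne_zero x)]
        by_cases hxU : x ∈ U <;> by_cases hxE : x ∈ E <;> simp [g, charFun, hxU, hxE]
    _ = ∑ i, ∫ x, lineDeriv ℝ (fun y => φ y i) x (EuclideanSpace.single i 1) * g x :=
        integral_finsetSum _ fun i _ => hint i
    _ ≤ ∑ i : Fin n, v * ‖EuclideanSpace.single i (1 : ℝ)‖ := by
        refine Finset.sum_le_sum fun i _ => ?_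
        exact hv.integral_lineDeriv_mul_le hv₀ hU hμU hE (hC i)
          (fun x => (PiLp.norm_apply_le (φ x) i).trans (hφ.norm_le_one x)) (hcompact i)
          ((hsupp i).trans hφ.tsupport_subset) _
    _ = n * v := by simp

theorem charFun_congr_ae {E E' : Set (Rn n)} (h : E =ᵐ[volume] E') :
    charFun E =ᵐ[volume] charFun E' :=
  indicator_ae_eq_of_ae_eq_set h

theorem totalVariation_congr_ae {u u' : Rn n → ℝ} (h : u =ᵐ[volume] u') (Ω : Set (Rn n)) :
    totalVariation u Ω = totalVariation u' Ω := by
  have hint : ∀ φ : Rn n → Rn n,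
      ∫ x in Ω, u x * divergence φ x = ∫ x in Ω, u' x * divergence φ x := fun φ =>
    integral_congr_ae (EventuallyEq.mul (ae_restrict_of_ae h) EventuallyEq.rfl)
  simp only [totalVariation, hint]

end TotalVariation

end NonlocalPerimeter

theorem theorem1p3_general (n : ℕ) {s lam : ℝ} (Lam : ℝ) {r R : ℝ} (hs₀ : 0 < s) (hs₁ : s < 1)
    (hlam : 0 < lam) (hr : 0 < r) (hrR : r < R) :
    ∃ C : ℝ≥0, ∀ K : NonlocalPerimeter.Rn n → ℝ, NonlocalPerimeter.KernelClassL2 s lam Lam K →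
      ∀ E : Set (NonlocalPerimeter.Rn n), NullMeasurableSet E volume →
        NonlocalPerimeter.IsStableSet K (Metric.ball 0 R) E →
          NonlocalPerimeter.MemBV (NonlocalPerimeter.charFun E) (Metric.ball 0 r) ∧
            NonlocalPerimeter.perimeter (Metric.ball 0 r) E ≤ (C : ℝ≥0∞) := by
  obtain ⟨v, hv, hjump⟩ :=
    NonlocalPerimeter.exists_hasJumpBound_of_isShearStable n hs₀ hs₁ hlam Lam hr hrR
  refine ⟨(n * v).toNNReal, fun K hK E ⟨E', hE'm, hEE'⟩ hE => ?_⟩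
  have hE' := hE.isShearStable.congr_ae hEE'
  have hchar := NonlocalPerimeter.charFun_congr_ae hEE'
  have hvar : NonlocalPerimeter.perimeter (Metric.ball 0 r) E ≤ ENNReal.ofReal (n * v) :=
    (NonlocalPerimeter.totalVariation_congr_ae hchar _).trans_le <|
      (hjump K hK E' hE'm hE').totalVariation_le hv Metric.isOpen_ball measure_ball_lt_top.ne hE'm
  have hint : IntegrableOn (NonlocalPerimeter.charFun E') (Metric.ball 0 r) :=
    (integrableOn_const measure_ball_lt_top.ne).indicator hE'm
  exact ⟨⟨hint.congr (ae_restrict_of_ae hchar.symm), hvar.trans_lt ENNReal.ofReal_lt_top⟩, hvar⟩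

theorem theorem1p3 (n : ℕ) (hn : 2 ≤ n) (s lam Lam : ℝ) (hs₀ : 0 < s) (hs₁ : s < 1)
    (hlam : 0 < lam) (hLam : lam ≤ Lam) :
    ∃ C : ℝ≥0, ∀ K : NonlocalPerimeter.Rn n → ℝ, NonlocalPerimeter.KernelClassL2 s lam Lam K →
      ∀ E : Set (NonlocalPerimeter.Rn n), NullMeasurableSet E volume →
        NonlocalPerimeter.IsStableSet K (Metric.ball 0 4) E →
          NonlocalPerimeter.MemBV (NonlocalPerimeter.charFun E) (Metric.ball 0 1) ∧
            NonlocalPerimeter.perimeter (Metric.ball 0 1) E ≤ (C : ℝ≥0∞) :=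
  theorem1p3_general n Lam hs₀ hs₁ hlam one_pos (by norm_num)
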